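/- Theorem. For a prime $p$ and a monic irreducible polynomial $\varphi\in\mathbb F_p[\xi]$ of degree $s\ge 1$, represent the field $\mathbb F_{p^s}$ as $\mathbb F_p[\xi]/\langle\varphi\rangle$ and its elements by their coordinate vectors in the basis $1,\xi,\dots,\xi^{s-1}$, with coordinates in $\{0,\dots,p-1\}$. There exists a deterministic polynomial-time algorithm which, given $p$, $s$, the coefficients of $\varphi$, elements $u,v,a_1,\dots,a_k\in\mathbb F_{p^s}$ ($k\ge 0$), and nonnegative integers $\alpha_1,\dots,\alpha_k,\beta_1,\dots,\beta_k$ such that \[ p>\alpha_j+\beta_j\quad\text{for all } 1\le j\le k, \] decides whether the polynomial \[ P=\sum_{j=1}^k a_jX^{\alpha_j}(uX+v)^{\beta_j}\in\mathbb F_{p^s}[X] \] is identically zero. Here all the integers in the input (including the exponents) are written in binary, the input size is the total number of bits of this list of integers (delimiters included), and polynomial time refers to bit complexity: there are one fixed program for a random access machine on nonnegative integers, with the operations $+$, truncated $-$, $\times$, quotient and remainder, and one fixed polynomial $q$, such that on every input as above of size $n$ the program halts with the correct answer (output $1$ if $P=0$, and $0$ if $P\ne 0$) at total cost at most $q(n)$.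 Each operation of the machine, including memory accesses, is charged the sum of the bit lengths of the numbers and addresses involved, except multiplication and division, which are charged the product of the bit lengths of their operands. -/

import Mathlib

/-!
# Random access machines with logarithmic (bit) cost

The memory consists of banks `0, 1, 2, …`, each of them an infinite array of registers that hold
natural numbers.  A program names only finitely many banks; within a bank, registers are addressed
indirectly by computed addresses.  Every operation is charged for the binary lengths of the numbers
it handles (multiplication and division are charged at the schoolbook rate), so the cost of a run
is a bound, up to lower-order factors, for the number of bit operations that it takes.
-/

namespace RAM

/-- A memory: `M b i` is the content of register `i` in bank `b`. -/
abbrev Mem : Type := ℕ → ℕ → ℕ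

/-- The number of bits of `n`, plus one (for a delimiter; so every number has positive length). -/
def len (n : ℕ) : ℕ := Nat.size n + 1

/-- Arithmetic expressions over the memory. -/
inductive Expr : Type
  | num (n : ℕ)
  | cell (b : ℕ) (e : Expr)
  | add (e₁ e₂ : Expr)
  | sub (e₁ e₂ : Expr)
  | mul (e₁ e₂ : Expr)
  | div (e₁ e₂ : Expr)
  | mod (e₁ e₂ : Expr)

/-- The value of an expression: `cell b e` is the content of the register of bank `b` whose address
is the value of `e`, subtraction is truncated at `0`, `div` and `mod` are quotient and remainder. -/
def Expr.eval (M : Mem) : Expr → ℕ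
  | num n => n
  | cell b e => M b (e.eval M)
  | add e₁ e₂ => e₁.eval M + e₂.eval M
  | sub e₁ e₂ => e₁.eval M - e₂.eval M
  | mul e₁ e₂ => e₁.eval M * e₂.eval M
  | div e₁ e₂ => e₁.eval M / e₂.eval M
  | mod e₁ e₂ => e₁.eval M % e₂.eval M

/-- The bit cost of evaluating an expression. -/
def Expr.cost (M : Mem) : Expr → ℕ
  | num n => len n
  | cell b e => e.cost M + len (e.eval M) + len (M b (e.eval M))
  | add e₁ e₂ => e₁.cost M + e₂.cost M + (len (e₁.eval M) + len (e₂.eval M))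
  | sub e₁ e₂ => e₁.cost M + e₂.cost M + (len (e₁.eval M) + len (e₂.eval M))
  | mul e₁ e₂ => e₁.cost M + e₂.cost M + len (e₁.eval M) * len (e₂.eval M)
  | div e₁ e₂ => e₁.cost M + e₂.cost M + len (e₁.eval M) * len (e₂.eval M)
  | mod e₁ e₂ => e₁.cost M + e₂.cost M + len (e₁.eval M) * len (e₂.eval M)

/-- Programs. `store b e₁ e₂` writes the value of `e₂` into the register of bank `b` with address
the value of `e₁`; a test `e` of a conditional or a loop succeeds if the value of `e` is nonzero. -/
inductive Prog : Type
  | skip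
  | store (b : ℕ) (e₁ e₂ : Expr)
  | seq (c₁ c₂ : Prog)
  | ite (e : Expr) (c₁ c₂ : Prog)
  | while (e : Expr) (c : Prog)

/-- The memory `M` with `n` written into register `i` of bank `b`. -/
def Mem.write (M : Mem) (b i n : ℕ) : Mem :=
  fun b' i' => if b' = b ∧ i' = i then n else M b' i'

/-- `Exec c M t M'`: started in memory `M`, the program `c` halts in memory `M'`, and the total bit
cost of the run is `t`. -/
inductive Exec : Prog → Mem → ℕ → Mem → Prop
  | skip (M : Mem) : Exec Prog.skip M 1 M
  | store (b : ℕ) (e₁ e₂ : Expr) (M : Mem) :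
      Exec (Prog.store b e₁ e₂) M
        (e₁.cost M + e₂.cost M + (len (e₁.eval M) + len (e₂.eval M)))
        (M.write b (e₁.eval M) (e₂.eval M))
  | seq {c₁ c₂ : Prog} {M M₁ M₂ : Mem} {t₁ t₂ : ℕ} :
      Exec c₁ M t₁ M₁ → Exec c₂ M₁ t₂ M₂ → Exec (Prog.seq c₁ c₂) M (t₁ + t₂) M₂
  | ite_true {e : Expr} {c₁ c₂ : Prog} {M M' : Mem} {t : ℕ} :
      e.eval M ≠ 0 → Exec c₁ M t M' → Exec (Prog.ite e c₁ c₂) M (e.cost M + 1 + t) M'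
  | ite_false {e : Expr} {c₁ c₂ : Prog} {M M' : Mem} {t : ℕ} :
      e.eval M = 0 → Exec c₂ M t M' → Exec (Prog.ite e c₁ c₂) M (e.cost M + 1 + t) M'
  | while_true {e : Expr} {c : Prog} {M M₁ M₂ : Mem} {t₁ t₂ : ℕ} :
      e.eval M ≠ 0 → Exec c M t₁ M₁ → Exec (Prog.while e c) M₁ t₂ M₂ →
      Exec (Prog.while e c) M (e.cost M + 1 + t₁ + t₂) M₂
  | while_false {e : Expr} {c : Prog} {M : Mem} :
      e.eval M = 0 → Exec (Prog.while e c) M (e.cost M + 1) M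

/-- The machine is deterministic: the final memory and the cost of a run are determined by the
program and the initial memory. -/
theorem Exec.deterministic {c : Prog} {M M₁ M₂ : Mem} {t₁ t₂ : ℕ}
    (h₁ : Exec c M t₁ M₁) (h₂ : Exec c M t₂ M₂) : t₁ = t₂ ∧ M₁ = M₂ := by
  induction h₁ generalizing t₂ M₂ with
  | skip M => cases h₂; exact ⟨rfl, rfl⟩
  | store b e₁ e₂ M => cases h₂; exact ⟨rfl, rfl⟩
  | seq _ _ ih₁ ih₂ =>
    cases h₂ with
    | seq g₁ g₂ =>
      obtain ⟨rfl, rfl⟩ := ih₁ g₁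
      obtain ⟨rfl, rfl⟩ := ih₂ g₂
      exact ⟨rfl, rfl⟩
  | ite_true he _ ih =>
    cases h₂ with
    | ite_true _ g => obtain ⟨rfl, rfl⟩ := ih g; exact ⟨rfl, rfl⟩
    | ite_false he' _ => exact absurd he' he
  | ite_false he _ ih =>
    cases h₂ with
    | ite_true he' _ => exact absurd he he'
    | ite_false _ g => obtain ⟨rfl, rfl⟩ := ih g; exact ⟨rfl, rfl⟩
  | while_true he _ _ ih₁ ih₂ =>
    cases h₂ with
    | while_true _ g₁ g₂ =>
      obtain ⟨rfl, rfl⟩ := ih₁ g₁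
      obtain ⟨rfl, rfl⟩ := ih₂ g₂
      exact ⟨rfl, rfl⟩
    | while_false he' => exact absurd he' he
  | while_false he =>
    cases h₂ with
    | while_true he' _ _ => exact absurd he he'
    | while_false _ => exact ⟨rfl, rfl⟩

/-- The initial memory on input `x`: the input occupies the first registers of bank `0`; every other
register contains `0`. -/
def init (x : List ℕ) : Mem := fun b i => if b = 0 then x.getD i 0 else 0

/-- The size of an input: its number of bits, delimiters included. -/
def inputSize (x : List ℕ) : ℕ := (x.map len).sum

/-- On input `x` the program `c` halts at bit cost `t` with output `y`; the output is read from
register `0` of bank `1`. -/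
def Outputs (c : Prog) (x : List ℕ) (t y : ℕ) : Prop :=
  ∃ M : Mem, Exec c (init x) t M ∧ M 1 0 = y

end RAM

namespace Lacunary

/-- The polynomial `∑ⱼ aⱼ X^αⱼ (u X + v)^βⱼ`. -/
noncomputable def poly {R : Type*} [CommRing R] (u v : R) {k : ℕ} (a : Fin k → R)
    (α β : Fin k → ℕ) : Polynomial R :=
  ∑ j, Polynomial.C (a j) * Polynomial.X ^ α j *
    (Polynomial.C u * Polynomial.X + Polynomial.C v) ^ β j

/-- The first `s` coefficients of a polynomial over `𝔽_p`, as integers in `{0, …, p - 1}`. -/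
def coeffs {p : ℕ} (s : ℕ) (f : Polynomial (ZMod p)) : List ℕ :=
  (List.range s).map fun i => (f.coeff i).val

/-- The coordinates of an element of `𝔽_p[ξ]/(φ)` in the basis `1, ξ, …, ξ^(s-1)`, `s = deg φ`: they
are the coefficients of its unique representative of degree less than `s`. -/
noncomputable def coords {p : ℕ} {φ : Polynomial (ZMod p)} (hφ : φ.Monic) (x : AdjoinRoot φ) :
    List ℕ :=
  coeffs φ.natDegree (AdjoinRoot.modByMonicHom hφ x)

/-- The lacunary representation of `∑ⱼ aⱼ X^αⱼ (u X + v)^βⱼ` over `𝔽_p[ξ]/(φ)`, `φ` monic of degree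
`s`: the numbers `p` and `s`, the `s` non-leading coefficients of `φ`, the coordinates of `u` and
of `v`, the number `k` of terms, and for each term the coordinates of `aⱼ` and the exponents `αⱼ`
and `βⱼ`. -/
noncomputable def encode {p : ℕ} {φ : Polynomial (ZMod p)} (hφ : φ.Monic) (u v : AdjoinRoot φ)
    {k : ℕ} (a : Fin k → AdjoinRoot φ) (α β : Fin k → ℕ) : List ℕ :=
  [p, φ.natDegree] ++ coeffs φ.natDegree φ ++ coords hφ u ++ coords hφ v ++ [k] ++
    (List.ofFn fun j => coords hφ (a j) ++ [α j, β j]).flatten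

end Lacunary

/-! Let w = cu + v with c = ±1, and suppose that w ≠ 0. Substituting c(1 + X) for X turns P into a
combination of k terms (1 + X)^α (w + UX)^β with U = cu, none of which vanishes at 0. The heart of
the proof is `order_sum_term_le`: a nonzero combination of this kind has order at most 2k² at 0,
whatever the exponents. Its span has some dimension m ≤ k and contains elements X^(e_j) r_j of m
distinct orders e_j. Apply the powers D^i, i < m, of the derivation D = X(1 + X)(w + UX) d/dX to
them and take the determinant. It equals X^(Σ e_j) times a polynomial whose value at 0 is a nonzero
multiple of the Vandermonde determinant of the numbers w·e_j; this is nonzero because the e_j are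
distinct and less than p. On the other hand, D^i multiplies each term by a polynomial of degree at
most 2i, so the same determinant is a constant times a product of terms times a determinant of
degree at most 2m². As the terms do not vanish at 0, Σ e_j ≤ 2m².

Since degrees are less than p, P is therefore zero as soon as the derivatives of order at most 2k²
vanish at 0 (`sum_term_eq_zero_iff`). Each term solves a first-order linear differential equation,
so these derivatives obey a three-term recurrence (`term_recurrence`); scaling the n-th one by w^n
makes it free of divisions. Only the starting value w^β requires binary powering.

Two cases are degenerate. If p is odd and both choices of c give w = 0, then u = v = 0; here w is
replaced by 1 and a factor 0^β is kept. If p = 2, the exponents are at most 1 and the two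
coefficients of P are computed directly.

For the bit complexity, a field element is packed into one integer, in a base so large that products
cause no carries; a ring operation is an integer operation followed by a normalisation
(`ensures_reduce`). All registers stay below one bound whose length is quadratic in the input size,
the number of steps is polynomial, and `Run.exec` converts both facts into a bound for the cost. -/

namespace RAM

/-! ### Bit lengths, and bit cost from register bounds and step counts. -/

theorem len_pos (n : ℕ) : 1 ≤ len n := Nat.le_add_left 1 _

theorem len_mono {m n : ℕ} (h : m ≤ n) : len m ≤ len n :=
  Nat.add_le_add_right (Nat.size_le_size h) 1

theorem len_mul_le (m n : ℕ) : len (m * n) ≤ len m + len n := by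
  have h : m * n < 2 ^ (Nat.size m + Nat.size n) := by
    rw [pow_add]
    exact Nat.mul_lt_mul'' (Nat.lt_size_self m) (Nat.lt_size_self n)
  have := Nat.size_le.2 h
  unfold len
  omega

theorem len_add_le (m n : ℕ) : len (m + n) ≤ len m + len n := by
  have h : m + n < 2 ^ (Nat.size m + Nat.size n + 1) := by
    have h1 := Nat.lt_size_self m
    have h2 := Nat.lt_size_self n
    have h3 : 2 ^ Nat.size m ≤ 2 ^ (Nat.size m + Nat.size n) :=
      Nat.pow_le_pow_right (by norm_num) (by omega)
    have h4 : 2 ^ Nat.size n ≤ 2 ^ (Nat.size m + Nat.size n) :=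
      Nat.pow_le_pow_right (by norm_num) (by omega)
    rw [pow_succ]
    omega
  have := Nat.size_le.2 h
  unfold len
  omega

theorem len_pow_le (m n : ℕ) : len (m ^ n) ≤ 2 + n * len m := by
  induction n with
  | zero => simp [len]
  | succ n ih =>
    have := len_mul_le (m ^ n) m
    rw [pow_succ, Nat.succ_mul]
    omega

theorem len_le_succ (n : ℕ) : len n ≤ n + 1 :=
  Nat.add_le_add_right (Nat.size_le.2 Nat.lt_two_pow_self) 1

/-- All registers contain numbers of size at most `V`. -/
def Bdd (V : ℕ) (M : Mem) : Prop := ∀ b i, M b i ≤ V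

theorem Bdd.write {V : ℕ} {M : Mem} (h : Bdd V M) {b i n : ℕ} (hn : n ≤ V) :
    Bdd V (M.write b i n) := by
  intro b' i'
  unfold Mem.write
  split_ifs
  · exact hn
  · exact h _ _

/-- If all registers have length at most `W`, the value of `e` has length at most `e.lenCoeff * W`. -/
def Expr.lenCoeff : Expr → ℕ
  | num n => len n
  | cell _ _ => 1
  | add e₁ e₂ => e₁.lenCoeff + e₂.lenCoeff
  | sub e₁ _ => e₁.lenCoeff
  | mul e₁ e₂ => e₁.lenCoeff + e₂.lenCoeff
  | div e₁ _ => e₁.lenCoeff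
  | mod e₁ _ => e₁.lenCoeff

/-- If all registers have length at most `W`, evaluating `e` costs at most `e.costCoeff * W ^ 2`. -/
def Expr.costCoeff : Expr → ℕ
  | num n => len n
  | cell _ e => e.costCoeff + e.lenCoeff + 1
  | add e₁ e₂ => e₁.costCoeff + e₂.costCoeff + (e₁.lenCoeff + e₂.lenCoeff)
  | sub e₁ e₂ => e₁.costCoeff + e₂.costCoeff + (e₁.lenCoeff + e₂.lenCoeff)
  | mul e₁ e₂ => e₁.costCoeff + e₂.costCoeff + e₁.lenCoeff * e₂.lenCoeff
  | div e₁ e₂ => e₁.costCoeff + e₂.costCoeff + e₁.lenCoeff * e₂.lenCoeff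
  | mod e₁ e₂ => e₁.costCoeff + e₂.costCoeff + e₁.lenCoeff * e₂.lenCoeff

/-- A sum or product is at most as long as its operands together; a difference, quotient or
remainder is at most as long as its first operand. So intermediate values need no bound of their
own. -/
theorem Expr.len_eval_le {V : ℕ} {M : Mem} (h : Bdd V M) (e : Expr) :
    len (e.eval M) ≤ e.lenCoeff * len V := by
  have hV := len_pos V
  induction e with
  | num n => exact Nat.le_mul_of_pos_right _ hV
  | cell b e _ => simpa [lenCoeff, eval] using len_mono (h b (e.eval M))
  | add e₁ e₂ h₁ h₂ =>
    have := len_add_le (e₁.eval M) (e₂.eval M)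
    simp only [lenCoeff, eval, Nat.add_mul]
    omega
  | sub e₁ e₂ h₁ h₂ => exact (len_mono (Nat.sub_le _ _)).trans h₁
  | mul e₁ e₂ h₁ h₂ =>
    have := len_mul_le (e₁.eval M) (e₂.eval M)
    simp only [lenCoeff, eval, Nat.add_mul]
    omega
  | div e₁ e₂ h₁ h₂ => exact (len_mono (Nat.div_le_self _ _)).trans h₁
  | mod e₁ e₂ h₁ h₂ => exact (len_mono (Nat.mod_le _ _)).trans h₁

theorem Expr.cost_le {V : ℕ} {M : Mem} (h : Bdd V M) (e : Expr) :
    e.cost M ≤ e.costCoeff * len V ^ 2 := by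
  have hV := len_pos V
  have hV2 : len V ≤ len V ^ 2 := Nat.le_self_pow two_ne_zero _
  have lin : ∀ e : Expr, len (e.eval M) ≤ e.lenCoeff * len V ^ 2 := fun e =>
    (e.len_eval_le h).trans (Nat.mul_le_mul_left _ hV2)
  have quad : ∀ e₁ e₂ : Expr, len (e₁.eval M) * len (e₂.eval M) ≤
      e₁.lenCoeff * e₂.lenCoeff * len V ^ 2 := fun e₁ e₂ =>
    (Nat.mul_le_mul (e₁.len_eval_le h) (e₂.len_eval_le h)).trans (le_of_eq (by ring))
  induction e with
  | num n => exact Nat.le_mul_of_pos_right _ (by positivity)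
  | cell b e ih =>
    have h1 := lin e
    have h2 := len_mono (h b (e.eval M))
    simp only [costCoeff, cost, Nat.add_mul]
    omega
  | add e₁ e₂ h₁ h₂ =>
    have h3 := lin e₁
    have h4 := lin e₂
    simp only [costCoeff, cost, Nat.add_mul]
    omega
  | sub e₁ e₂ h₁ h₂ =>
    have h3 := lin e₁
    have h4 := lin e₂
    simp only [costCoeff, cost, Nat.add_mul]
    omega
  | mul e₁ e₂ h₁ h₂ =>
    have h3 := quad e₁ e₂
    simp only [costCoeff, cost, Nat.add_mul]
    omega
  | div e₁ e₂ h₁ h₂ =>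
    have h3 := quad e₁ e₂
    simp only [costCoeff, cost, Nat.add_mul]
    omega
  | mod e₁ e₂ h₁ h₂ =>
    have h3 := quad e₁ e₂
    simp only [costCoeff, cost, Nat.add_mul]
    omega

/-- If all registers have length at most `W`, each elementary step of `c` costs at most
`c.stepCoeff * W ^ 2`. -/
def Prog.stepCoeff : Prog → ℕ
  | skip => 1
  | store _ e₁ e₂ => e₁.costCoeff + e₂.costCoeff + (e₁.lenCoeff + e₂.lenCoeff)
  | seq c₁ c₂ => c₁.stepCoeff + c₂.stepCoeff
  | ite e c₁ c₂ => e.costCoeff + 1 + c₁.stepCoeff + c₂.stepCoeff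
  | Prog.while e c => e.costCoeff + 1 + c.stepCoeff

/-- `Run V c M n M'`: started in `M`, the program `c` halts in `M'` after `n` elementary steps, and
whenever an expression is evaluated all registers are at most `V`. -/
inductive Run (V : ℕ) : Prog → Mem → ℕ → Mem → Prop
  | skip (M : Mem) : Run V Prog.skip M 1 M
  | store (b : ℕ) (e₁ e₂ : Expr) (M : Mem) : Bdd V M →
      Run V (Prog.store b e₁ e₂) M 1 (M.write b (e₁.eval M) (e₂.eval M))
  | seq {c₁ c₂ : Prog} {M M₁ M₂ : Mem} {n₁ n₂ : ℕ} :
      Run V c₁ M n₁ M₁ → Run V c₂ M₁ n₂ M₂ → Run V (Prog.seq c₁ c₂) M (n₁ + n₂) M₂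
  | ite_true {e : Expr} {c₁ c₂ : Prog} {M M' : Mem} {n : ℕ} : Bdd V M →
      e.eval M ≠ 0 → Run V c₁ M n M' → Run V (Prog.ite e c₁ c₂) M (1 + n) M'
  | ite_false {e : Expr} {c₁ c₂ : Prog} {M M' : Mem} {n : ℕ} : Bdd V M →
      e.eval M = 0 → Run V c₂ M n M' → Run V (Prog.ite e c₁ c₂) M (1 + n) M'
  | while_true {e : Expr} {c : Prog} {M M₁ M₂ : Mem} {n₁ n₂ : ℕ} : Bdd V M →
      e.eval M ≠ 0 → Run V c M n₁ M₁ → Run V (Prog.while e c) M₁ n₂ M₂ →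
      Run V (Prog.while e c) M (1 + n₁ + n₂) M₂
  | while_false {e : Expr} {c : Prog} {M : Mem} : Bdd V M →
      e.eval M = 0 → Run V (Prog.while e c) M 1 M

/-- For a fixed program `stepCoeff` is a constant, so this reduces the cost analysis to counting
steps and bounding the registers. -/
theorem Run.exec {V : ℕ} {c : Prog} {M M' : Mem} {n : ℕ} (h : Run V c M n M') :
    ∃ t, Exec c M t M' ∧ t ≤ n * (c.stepCoeff * len V ^ 2) := by
  have hV : 1 ≤ len V ^ 2 := Nat.one_le_pow _ _ (len_pos V)
  have hV2 : len V ≤ len V ^ 2 := Nat.le_self_pow two_ne_zero _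
  induction h with
  | skip M => exact ⟨1, .skip M, by simpa [Prog.stepCoeff] using hV⟩
  | store b e₁ e₂ M hM =>
    refine ⟨_, .store b e₁ e₂ M, ?_⟩
    have h1 := e₁.cost_le hM
    have h2 := e₂.cost_le hM
    have h3 := (e₁.len_eval_le hM).trans (Nat.mul_le_mul_left _ hV2)
    have h4 := (e₂.len_eval_le hM).trans (Nat.mul_le_mul_left _ hV2)
    simp only [Prog.stepCoeff, Nat.add_mul]
    omega
  | seq _ _ ih₁ ih₂ =>
    obtain ⟨t₁, h₁, b₁⟩ := ih₁
    obtain ⟨t₂, h₂, b₂⟩ := ih₂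
    refine ⟨_, .seq h₁ h₂, (Nat.add_le_add b₁ b₂).trans ?_⟩
    simp only [Prog.stepCoeff, Nat.add_mul, Nat.mul_add]
    omega
  | @ite_true e c₁ c₂ M M' n hM he _ ih =>
    obtain ⟨t, h, b⟩ := ih
    refine ⟨_, .ite_true he h, ?_⟩
    have := e.cost_le hM
    simp only [Prog.stepCoeff, Nat.add_mul, Nat.mul_add, one_mul]
    omega
  | @ite_false e c₁ c₂ M M' n hM he _ ih =>
    obtain ⟨t, h, b⟩ := ih
    refine ⟨_, .ite_false he h, ?_⟩
    have := e.cost_le hM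
    simp only [Prog.stepCoeff, Nat.add_mul, Nat.mul_add, one_mul]
    omega
  | @while_true e c M M₁ M₂ n₁ n₂ hM he _ _ ih₁ ih₂ =>
    obtain ⟨t₁, h₁, b₁⟩ := ih₁
    obtain ⟨t₂, h₂, b₂⟩ := ih₂
    refine ⟨_, .while_true he h₁ h₂, ?_⟩
    have := e.cost_le hM
    simp only [Prog.stepCoeff, Nat.add_mul, Nat.mul_add, one_mul] at *
    omega
  | @while_false e c M hM he =>
    refine ⟨_, .while_false he, ?_⟩
    have := e.cost_le hM
    simp only [Prog.stepCoeff, Nat.add_mul, one_mul]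
    omega

/-! ### Rules for total correctness with a step budget. -/

/-- Started in `M` with all registers at most `V`, the program `c` halts within `n` elementary
steps, keeps all registers at most `V`, and establishes `Q`. -/
def Ensures (V : ℕ) (c : Prog) (n : ℕ) (M : Mem) (Q : Mem → Prop) : Prop :=
  Bdd V M → ∃ M' m, m ≤ n ∧ Run V c M m M' ∧ Bdd V M' ∧ Q M'

variable {V n n₁ n₂ : ℕ} {M : Mem} {Q : Mem → Prop}

theorem Ensures.mono {c : Prog} {Q' : Mem → Prop} (h : Ensures V c n₁ M Q') (hn : n₁ ≤ n)
    (hQ : ∀ M', Q' M' → Q M') : Ensures V c n M Q := fun hM =>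
  let ⟨M', m, hm, hr, hb, hq⟩ := h hM
  ⟨M', m, hm.trans hn, hr, hb, hQ _ hq⟩

theorem ensures_skip (h : Q M) : Ensures V Prog.skip 1 M Q :=
  fun hM => ⟨M, 1, le_rfl, .skip M, hM, h⟩

/-- Only the stored value has to respect the bound; the length of the address is controlled by its
expression. -/
theorem ensures_store {b : ℕ} {e₁ e₂ : Expr} (hV : e₂.eval M ≤ V)
    (h : Q (M.write b (e₁.eval M) (e₂.eval M))) : Ensures V (Prog.store b e₁ e₂) 1 M Q :=
  fun hM => ⟨_, 1, le_rfl, .store b e₁ e₂ M hM, hM.write hV, h⟩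

/-- The postcondition of the first program is the specification of the second, so a program is
verified by symbolic execution from left to right. -/
theorem ensures_seq {c₁ c₂ : Prog}
    (h : Ensures V c₁ n₁ M fun M' => Ensures V c₂ n₂ M' Q) :
    Ensures V (Prog.seq c₁ c₂) (n₁ + n₂) M Q := fun hM =>
  let ⟨_, _, hm₁, hr₁, hb₁, hq₁⟩ := h hM
  let ⟨M₂, _, hm₂, hr₂, hb₂, hq₂⟩ := hq₁ hb₁
  ⟨M₂, _, Nat.add_le_add hm₁ hm₂, .seq hr₁ hr₂, hb₂, hq₂⟩

theorem ensures_ite {e : Expr} {c₁ c₂ : Prog} (h₁ : e.eval M ≠ 0 → Ensures V c₁ n M Q)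
    (h₂ : e.eval M = 0 → Ensures V c₂ n M Q) : Ensures V (Prog.ite e c₁ c₂) (1 + n) M Q := by
  intro hM
  by_cases he : e.eval M = 0
  · obtain ⟨M', m, hm, hr, hb, hq⟩ := h₂ he hM
    exact ⟨M', _, Nat.add_le_add_left hm 1, .ite_false hM he hr, hb, hq⟩
  · obtain ⟨M', m, hm, hr, hb, hq⟩ := h₁ he hM
    exact ⟨M', _, Nat.add_le_add_left hm 1, .ite_true hM he hr, hb, hq⟩

/-- A loop that is executed `k` times; `I i` is the invariant when `i` rounds are left. -/
theorem ensures_while {e : Expr} {c : Prog} {k : ℕ} (I : ℕ → Mem → Prop) (h : I k M)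
    (h0 : ∀ M', I 0 M' → e.eval M' = 0)
    (hs : ∀ i M', i < k → I (i + 1) M' → e.eval M' ≠ 0 ∧ Ensures V c n M' (I i))
    (hQ : ∀ M', I 0 M' → Q M') :
    Ensures V (Prog.while e c) (k * (1 + n) + 1) M Q := by
  induction k generalizing M with
  | zero => exact fun hM => ⟨M, 1, by simp, .while_false hM (h0 M h), hM, hQ M h⟩
  | succ k ih =>
    intro hM
    obtain ⟨he, hc⟩ := hs k M (Nat.lt_succ_self k) h
    obtain ⟨M₁, m₁, hm₁, hr₁, hb₁, hq₁⟩ := hc hM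
    obtain ⟨M₂, m₂, hm₂, hr₂, hb₂, hq₂⟩ :=
      ih hq₁ (fun i M' hi => hs i M' (hi.trans (Nat.lt_succ_self k))) hb₁
    refine ⟨M₂, _, ?_, .while_true hM he hr₁ hr₂, hb₂, hq₂⟩
    rw [Nat.succ_mul]
    omega

end RAM

/-! ### Differential equation of a term, and the order at 0 of a sum of terms. -/

namespace Lacunary

open Polynomial

section CommRing

variable {R : Type*} [CommRing R]

/-- The polynomial `(1 + X)^α (w + u X)^β`. -/
noncomputable def term (u w : R) (α β : ℕ) : R[X] := (1 + X) ^ α * (C w + C u * X) ^ β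

/-- The logarithmic derivative is α/(1 + X) + βu/(w + uX); this is that identity with denominators
cleared. -/
theorem term_ode (u w : R) (α β : ℕ) :
    (1 + X) * (C w + C u * X) * derivative (term u w α β) =
      (C (α : R) * (C w + C u * X) + C (β : R) * C u * (1 + X)) * term u w α β := by
  unfold term
  simp only [derivative_mul, derivative_pow, derivative_add, derivative_one, derivative_X,
    derivative_C, zero_add, mul_one, zero_mul]
  rcases α with _ | α <;> rcases β with _ | β <;> simp [pow_succ] <;> ring

/-- The scaled derivatives of a term at `0` satisfy a three-term recurrence. -/
theorem term_recurrence (u w : R) (α β n : ℕ) :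
    let z : ℕ → R := fun n => w ^ n * (derivative^[n] (term u w α β)).coeff 0
    z (n + 1) = ((α - n) * w + (β - n) * u) * z n +
      n * (α + β + 1 - n) * (u * w * z (n - 1)) := by
  intro z
  -- The differential equation differentiated n times. Its coefficients have degrees 2 and 1, so
  -- only three consecutive derivatives survive.
  have main : ∀ n, (1 + X) * (C w + C u * X) * derivative^[n + 1] (term u w α β) =
      ((C (α : R) * (C w + C u * X) + C (β : R) * C u * (1 + X)) -
        C (n : R) * (C w + C u * X + C u * (1 + X))) * derivative^[n] (term u w α β) +
      C (n : R) * C (α + β + 1 - n : R) * C u * derivative^[n - 1] (term u w α β) := by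
    intro n
    induction n with
    | zero => simpa using term_ode u w α β
    | succ n ih =>
      have := congrArg derivative ih
      rw [Nat.add_sub_cancel]
      -- For n = 0 the truncated index n - 1 is harmless, because the factor n vanishes.
      have hn : C (n : R) * derivative (derivative^[n - 1] (term u w α β)) =
          C (n : R) * derivative^[n] (term u w α β) := by
        rcases n with _ | n
        · simp
        · rw [Nat.add_sub_cancel, ← Function.iterate_succ_apply' derivative]
      simp only [derivative_mul, derivative_add, derivative_sub, derivative_one, derivative_X,
        derivative_C, zero_add, add_zero, mul_one, zero_mul, one_mul, mul_zero,
        ← Function.iterate_succ_apply' derivative] at this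
      simp only [C_add, C_sub, C_1, Nat.cast_add, Nat.cast_one, Nat.succ_eq_add_one] at this ⊢
      simp only [Function.iterate_succ_apply'] at this ⊢ hn
      linear_combination this + (C (α : R) + C (β : R) + 1 - C (n : R)) * C u * hn
  -- At 0 the leading coefficient is w. The scaling by powers of w absorbs it, so w is never
  -- inverted.
  have h0 := congrArg (fun f : R[X] => f.coeff 0) (main n)
  simp only [mul_coeff_zero, coeff_add, coeff_sub, coeff_C_zero, coeff_one_zero, coeff_X_zero,
    mul_zero, add_zero, mul_one, one_mul] at h0
  simp only [z]
  rcases n with _ | n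
  · simp at h0 ⊢
    linear_combination h0
  · rw [Nat.add_sub_cancel] at h0 ⊢
    push_cast at h0 ⊢
    linear_combination w ^ (n + 1) * h0

end CommRing

variable {F : Type*} [Field F]

/-- A finite-dimensional space of polynomials contains polynomials of as many distinct orders at `0`
as its dimension, and these are the only orders that occur. -/
theorem exists_distinct_orders (n : ℕ) (V : Submodule F F[X]) [FiniteDimensional F V]
    (hn : Module.finrank F V = n) :
    ∃ (e : Fin n → ℕ) (r : Fin n → F[X]), Function.Injective e ∧ (∀ j, X ^ e j * r j ∈ V) ∧
      (∀ j, (r j).coeff 0 ≠ 0) ∧ ∀ P ∈ V, P ≠ 0 → ∀ d, X ^ d ∣ P → ∃ j, d ≤ e j := by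
  induction n generalizing V with
  | zero =>
    refine ⟨Fin.elim0, Fin.elim0, fun i => i.elim0, fun i => i.elim0, fun i => i.elim0, ?_⟩
    intro P hP hP0
    rw [Submodule.finrank_eq_zero.1 hn, Submodule.mem_bot] at hP
    exact absurd hP hP0
  | succ n ih =>
    obtain ⟨P₀, hP₀, hP₀0⟩ := Submodule.exists_mem_ne_zero_of_ne_bot
      (p := V) (fun h => by rw [h, finrank_bot] at hn; omega)
    obtain ⟨d₀, hd⟩ : ∃ d, P₀.natTrailingDegree = d := ⟨_, rfl⟩
    let l : V →ₗ[F] F := (lcoeff F d₀).domRestrict V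
    have hl : Function.Surjective l := by
      apply LinearMap.surjective
      intro h
      have := LinearMap.congr_fun h ⟨P₀, hP₀⟩
      apply trailingCoeff_nonzero_iff_nonzero.2 hP₀0
      simpa [l, trailingCoeff, hd] using this
    have hrank := l.finrank_range_add_finrank_ker
    rw [LinearMap.range_eq_top.2 hl, finrank_top, Module.finrank_self, hn] at hrank
    -- Removing the order d₀ of P₀: the elements with zero coefficient at d₀ form a space of
    -- dimension n in which the order d₀ does not occur.
    let V' : Submodule F F[X] := (LinearMap.ker l).map V.subtype
    have hV' : ∀ P, P ∈ V' ↔ P ∈ V ∧ P.coeff d₀ = 0 := by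
      intro P
      simp [V', l, and_comm]
    have hn' : Module.finrank F V' = n := by
      rw [Submodule.finrank_map_subtype_eq]
      omega
    obtain ⟨e, r, he, hr, hr0, hord⟩ := ih V' hn'
    have hX : X ^ d₀ ∣ P₀ := X_pow_dvd_iff.2 fun i hi =>
      coeff_eq_zero_of_lt_natTrailingDegree (hd ▸ hi)
    obtain ⟨r₀, hr₀⟩ := hX
    have hcoeff : ∀ P : F[X], (X ^ d₀ * P).coeff d₀ = P.coeff 0 := fun P => by
      simpa using coeff_X_pow_mul P d₀ 0
    have hne : ∀ j, e j ≠ d₀ := by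
      intro j hj
      have := ((hV' _).1 (hr j)).2
      rw [hj, hcoeff] at this
      exact hr0 j this
    refine ⟨Fin.cons d₀ e, Fin.cons r₀ r, ?_, ?_, ?_, ?_⟩
    · exact Fin.cons_injective_iff.2 ⟨by rintro ⟨j, hj⟩; exact hne j hj, he⟩
    · intro j
      refine Fin.cases ?_ (fun j => ?_) j
      · simpa [← hr₀] using hP₀
      · simpa using ((hV' _).1 (hr j)).1
    · intro j
      refine Fin.cases ?_ (fun j => ?_) j
      · have := trailingCoeff_nonzero_iff_nonzero.2 hP₀0
        rw [trailingCoeff, hd, hr₀, hcoeff] at this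
        simpa using this
      · simpa using hr0 j
    · intro P hP hP0 d hdP
      by_cases h : P.coeff d₀ = 0
      · obtain ⟨j, hj⟩ := hord P ((hV' P).2 ⟨hP, h⟩) hP0 d hdP
        exact ⟨j.succ, by simpa using hj⟩
      · refine ⟨0, ?_⟩
        by_contra hlt
        exact h (X_pow_dvd_iff.1 hdP d₀ (by simpa using hlt))

/-- The derivation `X (1 + X) (w + u X) d/dX`. -/
noncomputable def eulerOp (u w : F) : F[X] →ₗ[F] F[X] :=
  (LinearMap.mulLeft F (X * (1 + X) * (C w + C u * X))).comp derivative

theorem eulerOp_apply (u w : F) (f : F[X]) :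
    eulerOp u w f = X * (1 + X) * (C w + C u * X) * derivative f := rfl

/-- Because of the factor X the operator does not lower orders; on lowest terms it acts as w·X·d/dX,
with eigenvalue we on X^e. -/
theorem eulerOp_pow_X_pow_mul (u w : F) (e : ℕ) (r : F[X]) (i : ℕ) :
    ∃ r' : F[X], (eulerOp u w ^ i) (X ^ e * r) = X ^ e * r' ∧
      r'.coeff 0 = (w * e) ^ i * r.coeff 0 := by
  induction i with
  | zero => exact ⟨r, by simp, by simp⟩
  | succ i ih =>
    obtain ⟨r', h, h0⟩ := ih
    refine ⟨(1 + X) * (C w + C u * X) * (C (e : F) * r' + X * derivative r'), ?_, ?_⟩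
    · rw [pow_succ', Module.End.mul_apply, h, eulerOp_apply, derivative_mul, derivative_X_pow]
      rcases e with _ | e
      · simp
        ring
      · simp only [Nat.add_sub_cancel, pow_succ]
        ring
    · rw [pow_succ', mul_assoc (w * (e : F)), ← h0]
      simp [mul_coeff_zero]
      ring

/-- The factor (1 + X)(w + uX) clears the denominators of the logarithmic derivative, and each
application raises the degree of the cofactor by at most 2, independently of α and β. -/
theorem eulerOp_pow_term (u w : F) (α β i : ℕ) :
    ∃ h : F[X], (eulerOp u w ^ i) (term u w α β) = h * term u w α β ∧ h.natDegree ≤ 2 * i := by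
  induction i with
  | zero => exact ⟨1, by simp, by simp⟩
  | succ i ih =>
    obtain ⟨h, hh, hd⟩ := ih
    refine ⟨X * (1 + X) * (C w + C u * X) * derivative h +
      X * (C (α : F) * (C w + C u * X) + C (β : F) * C u * (1 + X)) * h, ?_, ?_⟩
    · rw [pow_succ', Module.End.mul_apply, hh, eulerOp_apply, derivative_mul]
      linear_combination (X * h) * term_ode u w α β
    · refine natDegree_add_le_of_degree_le ?_ ?_
      · by_cases h0 : derivative h = 0
        · simp [h0]
        · have h1 : h.natDegree ≠ 0 := fun h1 => h0 (derivative_of_natDegree_zero h1)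
          have h2 := natDegree_derivative_le h
          have h3 : (X * (1 + X) * (C w + C u * X)).natDegree ≤ 3 := by compute_degree
          refine natDegree_mul_le.trans ?_
          omega
      · have h3 : (X * (C (α : F) * (C w + C u * X) + C (β : F) * C u * (1 + X))).natDegree ≤ 2 := by
          compute_degree
        refine natDegree_mul_le.trans ?_
        omega

theorem natDegree_det_le {m d : ℕ} (A : Matrix (Fin m) (Fin m) F[X])
    (h : ∀ i j, (A i j).natDegree ≤ d) : A.det.natDegree ≤ m * d := by
  rw [Matrix.det_apply]
  refine natDegree_sum_le_of_forall_le _ _ fun σ _ => ?_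
  refine (natDegree_smul_le _ _).trans ((natDegree_prod_le _ _).trans ?_)
  refine (Finset.sum_le_sum fun i _ => h (σ i) i).trans ?_
  simp

theorem natDegree_term_le (u w : F) (α β : ℕ) : (term u w α β).natDegree ≤ α + β := by
  unfold term
  refine natDegree_mul_le.trans (Nat.add_le_add ?_ ?_)
  · exact natDegree_pow_le_of_le α (m := 1) (by compute_degree) |>.trans (by simp)
  · exact natDegree_pow_le_of_le β (m := 1) (by compute_degree) |>.trans (by simp)

theorem order_sum_term_le {p : ℕ} [CharP F p] {u w : F} (hw : w ≠ 0) {k : ℕ} {α β : Fin k → ℕ}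
    (hp : ∀ j, α j + β j < p) (b : Fin k → F) (hP : ∑ j, C (b j) * term u w (α j) (β j) ≠ 0)
    {d : ℕ} (hd : X ^ d ∣ ∑ j, C (b j) * term u w (α j) (β j)) : d ≤ 2 * k ^ 2 := by
  set f : Fin k → F[X] := fun j => term u w (α j) (β j) with hf
  set V : Submodule F F[X] := Submodule.span F (Set.range f) with hV
  obtain ⟨m, hm⟩ : ∃ m, Module.finrank F V = m := ⟨_, rfl⟩
  have hmk : m ≤ k := by
    rw [← hm]
    simpa [Set.finrank] using finrank_range_le_card (R := F) f
  have : FiniteDimensional F V := FiniteDimensional.span_of_finite F (Set.finite_range f)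
  obtain ⟨e, r, he, hrV, hr0, hord⟩ := exists_distinct_orders m V hm
  have hdeg : ∀ P ∈ V, P.degree < p := by
    intro P hP
    rw [← mem_degreeLT]
    refine Submodule.span_le.2 ?_ hP
    rintro _ ⟨j, rfl⟩
    rw [SetLike.mem_coe, mem_degreeLT]
    refine degree_le_natDegree.trans_lt ?_
    exact_mod_cast (natDegree_term_le u w (α j) (β j)).trans_lt (hp j)
  -- The assumption on the exponents enters here: orders are at most degrees, hence less than p, and
  -- distinct orders stay distinct in F.
  have hep : ∀ j, e j < p := by
    intro j
    have h1 := hdeg _ (hrV j)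
    by_contra hlt
    have h2 := coeff_eq_zero_of_degree_lt (n := e j) (h1.trans_le (by exact_mod_cast not_lt.1 hlt))
    have h3 := coeff_X_pow_mul (r j) (e j) 0
    rw [zero_add, h2] at h3
    exact hr0 j h3.symm
  -- The terms may be linearly dependent, so m of them that span are selected.
  obtain ⟨σ, hσ⟩ : ∃ σ : Fin m → Fin k, Submodule.span F (Set.range (f ∘ σ)) = V := by
    obtain ⟨t, ht, hspan, -⟩ := Submodule.exists_fun_fin_finrank_span_eq F (Set.range f)
    subst hm
    choose σ hσ using fun i => ht i
    refine ⟨σ, ?_⟩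
    refine Eq.trans ?_ hspan
    congr 2
    funext i
    exact hσ i
  have hA : ∀ j, ∃ a : Fin m → F, ∑ i, a i • f (σ i) = X ^ e j * r j := by
    intro j
    have := hrV j
    rw [← hσ] at this
    exact (Submodule.mem_span_range_iff_exists_fun F).1 this
  choose A hA using hA
  choose h hh hhd using fun (i j : Fin m) =>
    eulerOp_pow_term u w (α (σ j)) (β (σ j)) (i : ℕ)
  choose R hR hR0 using fun (i j : Fin m) => eulerOp_pow_X_pow_mul u w (e j) (r j) (i : ℕ)
  -- The determinant of the i-th powers of `eulerOp` on X^(e_j) r_j, computed twice: by taking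
  -- X^(e_j) out of the columns, and by changing basis to the terms and taking these out.
  have key : (∏ j, X ^ e j) * (Matrix.of R).det =
      (Matrix.of h).det * ((∏ j, f (σ j)) * C (Matrix.of fun i j => A j i).det) := by
    have h1 := Matrix.det_mul_row (fun j => (X : F[X]) ^ e j) (Matrix.of R)
    have h2 := Matrix.det_mul_row (fun j => f (σ j)) (Matrix.of h)
    rw [← h1, ← mul_assoc, mul_comm (Matrix.of h).det, ← h2, RingHom.map_det, ← Matrix.det_mul]
    congr 1
    ext1 i j
    rw [Matrix.mul_apply, Matrix.of_apply, Matrix.of_apply, ← hR, ← hA, map_sum]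
    refine Finset.sum_congr rfl fun l _ => ?_
    rw [map_smul, hf, hh]
    simp only [ Matrix.of_apply, RingHom.mapMatrix_apply, Matrix.map_apply,
      smul_eq_C_mul]
    ring
  -- At 0 the matrix is a transposed Vandermonde matrix with nodes w·e_j, its columns scaled by
  -- r_j(0).
  have hRdet : (Matrix.of R).det.coeff 0 ≠ 0 := by
    rw [coeff_zero_eq_eval_zero, ← coe_evalRingHom, RingHom.map_det]
    have h1 := Matrix.det_mul_row (fun j => (r j).coeff 0)
      (Matrix.vandermonde fun j => w * (e j : F)).transpose
    have h2 : (evalRingHom 0).mapMatrix (Matrix.of R) = Matrix.of fun i j => (r j).coeff 0 *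
        (Matrix.vandermonde fun j => w * (e j : F)).transpose i j := by
      ext i j
      simp [← coeff_zero_eq_eval_zero, hR0, Matrix.vandermonde_apply, mul_comm]
    rw [h2, h1, Matrix.det_transpose]
    refine mul_ne_zero (Finset.prod_ne_zero_iff.2 fun j _ => hr0 j) ?_
    rw [Matrix.det_vandermonde_ne_zero_iff]
    intro i j hij
    have := CharP.natCast_injOn_Iio F p (hep i) (hep j) (mul_left_cancel₀ hw hij)
    exact he this
  have hRne : (Matrix.of R).det ≠ 0 := fun h0 => hRdet (by rw [h0, coeff_zero])
  have hne : (Matrix.of h).det * ((∏ j, f (σ j)) * C (Matrix.of fun i j => A j i).det) ≠ 0 := by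
    rw [← key]
    exact mul_ne_zero (Finset.prod_ne_zero_iff.2 fun j _ => pow_ne_zero _ X_ne_zero) hRne
  -- A term takes the value w^β ≠ 0 at 0, so the whole power of X must divide the determinant of the
  -- cofactors.
  have hX : ¬ X ∣ (∏ j, f (σ j)) * C (Matrix.of fun i j => A j i).det := by
    rw [X_dvd_iff, mul_coeff_zero, coeff_C_zero, mul_eq_zero, not_or]
    constructor
    · rw [coeff_zero_eq_eval_zero, eval_prod]
      exact Finset.prod_ne_zero_iff.2 fun j _ => by simp [hf, term, hw]
    · intro h0
      exact hne (by rw [h0]; simp)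
  have hdvd : X ^ (∑ j, e j) ∣ (Matrix.of h).det := by
    refine prime_X.pow_dvd_of_dvd_mul_right _ hX ?_
    rw [← key, Finset.prod_pow_eq_pow_sum]
    exact dvd_mul_right _ _
  have hle := natDegree_le_of_dvd hdvd (left_ne_zero_of_mul hne)
  rw [natDegree_X_pow] at hle
  have hle2 := natDegree_det_le (Matrix.of h) (d := 2 * m) fun i j =>
    (hhd i j).trans (by have := i.isLt; omega)
  obtain ⟨j, hj⟩ := hord _ (Submodule.sum_mem _ fun j _ => by
    rw [← smul_eq_C_mul]
    exact Submodule.smul_mem _ _ (Submodule.subset_span ⟨j, rfl⟩)) hP d hd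
  -- d ≤ e_j ≤ Σ e_i ≤ m·2m ≤ 2k².
  have hj2 := Finset.single_le_sum (fun i _ => Nat.zero_le (e i)) (Finset.mem_univ j)
  nlinarith

/-- A polynomial of degree less than `p` in characteristic `p` is divisible by `X ^ N` or zero if
its first `N` derivatives vanish at `0`. -/
theorem X_pow_dvd_of_iterate_derivative {p : ℕ} [Fact p.Prime] [CharP F p] {P : F[X]} {N : ℕ}
    (hP : P.degree < p) (h : ∀ n < N, (derivative^[n] P).coeff 0 = 0) : X ^ N ∣ P := by
  refine X_pow_dvd_iff.2 fun n hn => ?_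
  by_cases hnp : n < p
  · have := h n hn
    -- The n-th derivative at 0 is n! times the n-th coefficient, and n! is invertible for n < p.
    rw [coeff_iterate_derivative, zero_add, Nat.descFactorial_self, nsmul_eq_mul] at this
    refine (mul_eq_zero.1 this).resolve_left ?_
    rw [CharP.cast_eq_zero_iff F p, (Fact.out : p.Prime).dvd_factorial]
    omega
  · exact coeff_eq_zero_of_degree_lt (hP.trans_le (by exact_mod_cast not_lt.1 hnp))

/-- The finite test behind the algorithm: if all N scaled derivatives vanish, the order is at least
N > 2k² or the sum is zero. -/
theorem sum_term_eq_zero_iff {p : ℕ} [Fact p.Prime] [CharP F p] {u w : F} (hw : w ≠ 0) {k : ℕ}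
    {α β : Fin k → ℕ} (hp : ∀ j, α j + β j < p) (b : Fin k → F) {N : ℕ} (hN : 2 * k ^ 2 < N) :
    ∑ j, C (b j) * term u w (α j) (β j) = 0 ↔
      ∀ n < N, ∑ j, b j * (w ^ n * (derivative^[n] (term u w (α j) (β j))).coeff 0) = 0 := by
  have hco : ∀ n, ∑ j, b j * (w ^ n * (derivative^[n] (term u w (α j) (β j))).coeff 0) =
      w ^ n * (derivative^[n] (∑ j, C (b j) * term u w (α j) (β j))).coeff 0 := by
    intro n
    rw [iterate_derivative_sum, finsetSum_coeff, Finset.mul_sum]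
    refine Finset.sum_congr rfl fun j _ => ?_
    rw [iterate_derivative_C_mul, coeff_C_mul]
    ring
  constructor
  · intro h n _
    rw [hco, h]
    simp
  · intro h
    by_contra hne
    refine absurd (order_sum_term_le hw hp b hne (d := N) ?_) (by omega)
    refine X_pow_dvd_of_iterate_derivative (p := p) ?_ fun n hn => ?_
    · have hpp : (0 : ℕ) < p := (Fact.out : p.Prime).pos
      refine (degree_sum_le _ _).trans_lt ((Finset.sup_lt_iff ?_).2 fun j _ => ?_)
      · exact WithBot.bot_lt_coe _
      · refine degree_le_natDegree.trans_lt ?_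
        exact_mod_cast ((natDegree_C_mul_le _ _).trans (natDegree_term_le u w (α j) (β j))).trans_lt (hp j)
    · have := h n hn
      rw [hco] at this
      exact (mul_eq_zero.1 this).resolve_left (pow_ne_zero _ hw)

end Lacunary

/-! ### Ring elements packed as digits of an integer. -/

namespace Lacunary

open Polynomial

/-- `z` has an expansion `∑ dᵢ Bⁱ` with `m` digits `dᵢ ≤ D`, and `x = ∑ dᵢ ξⁱ`. -/
def Digits {R : Type*} [CommRing R] (B : ℕ) (ξ : R) (m D z : ℕ) (x : R) : Prop :=
  ∃ d : ℕ → ℕ, (∀ i, d i ≤ D) ∧ z = ∑ i ∈ Finset.range m, d i * B ^ i ∧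
    x = ∑ i ∈ Finset.range m, (d i : R) * ξ ^ i

namespace Digits

variable {R : Type*} [CommRing R] {B : ℕ} {ξ : R} {m m' D D' E y z : ℕ} {x x' : R}

theorem mono (h : Digits B ξ m D z x) (hm : m ≤ m') (hD : D ≤ D') : Digits B ξ m' D' z x := by
  obtain ⟨d, hd, rfl, rfl⟩ := h
  have hsub : Finset.range m ⊆ Finset.range m' := Finset.range_subset_range.2 hm
  refine ⟨fun i => if i < m then d i else 0, fun i => ?_, ?_, ?_⟩
  · dsimp only
    split_ifs
    · exact (hd i).trans hD
    · exact Nat.zero_le _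
  · rw [← Finset.sum_subset hsub]
    · exact Finset.sum_congr rfl fun i hi => by simp [Finset.mem_range.1 hi]
    · intro i _ hi
      simp [mt Finset.mem_range.2 hi]
  · rw [← Finset.sum_subset hsub]
    · exact Finset.sum_congr rfl fun i hi => by simp [Finset.mem_range.1 hi]
    · intro i _ hi
      simp [mt Finset.mem_range.2 hi]

theorem zero : Digits B ξ m 0 0 (0 : R) := ⟨fun _ => 0, by simp, by simp, by simp⟩

theorem add (h : Digits B ξ m D z x) (h' : Digits B ξ m D' y x') :
    Digits B ξ m (D + D') (z + y) (x + x') := by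
  obtain ⟨d, hd, rfl, rfl⟩ := h
  obtain ⟨d', hd', rfl, rfl⟩ := h'
  refine ⟨fun i => d i + d' i, fun i => Nat.add_le_add (hd i) (hd' i), ?_, ?_⟩
  · simp [add_mul, Finset.sum_add_distrib]
  · simp [add_mul, Finset.sum_add_distrib]

theorem natCast_mul (n : ℕ) (h : Digits B ξ m D z x) : Digits B ξ m (n * D) (n * z) (n * x) := by
  obtain ⟨d, hd, rfl, rfl⟩ := h
  refine ⟨fun i => n * d i, fun i => Nat.mul_le_mul_left n (hd i), ?_, ?_⟩
  · simp [mul_assoc, Finset.mul_sum]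
  · simp [mul_assoc, Finset.mul_sum]

theorem shift (n : ℕ) (h : Digits B ξ m D z x) :
    Digits B ξ (n + m) D (B ^ n * z) (ξ ^ n * x) := by
  obtain ⟨d, hd, rfl, rfl⟩ := h
  refine ⟨fun i => if i < n then 0 else d (i - n), fun i => ?_, ?_, ?_⟩
  · dsimp only
    split_ifs
    · exact Nat.zero_le _
    · exact hd _
  · rw [Finset.mul_sum, Finset.sum_range_add, Finset.sum_eq_zero (s := Finset.range n), zero_add]
    · exact Finset.sum_congr rfl fun i _ => by simp [pow_add]; ring
    · intro i hi
      simp [Finset.mem_range.1 hi]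
  · rw [Finset.mul_sum, Finset.sum_range_add, Finset.sum_eq_zero (s := Finset.range n), zero_add]
    · exact Finset.sum_congr rfl fun i _ => by simp [pow_add]; ring
    · intro i hi
      simp [Finset.mem_range.1 hi]

theorem sum {ι : Type*} (S : Finset ι) {z : ι → ℕ} {x : ι → R}
    (h : ∀ i ∈ S, Digits B ξ m D (z i) (x i)) :
    Digits B ξ m (S.card * D) (∑ i ∈ S, z i) (∑ i ∈ S, x i) := by
  classical
  induction S using Finset.induction_on with
  | empty => simpa using zero
  | insert a S ha ih =>
    rw [Finset.sum_insert ha, Finset.sum_insert ha, Finset.card_insert_of_notMem ha, add_mul,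
      one_mul, add_comm (S.card * D)]
    exact (h a (Finset.mem_insert_self a S)).add
      (ih fun i hi => h i (Finset.mem_insert_of_mem hi))

/-- Integer multiplication convolves the digit sequences; every new digit is a sum of at most m
products. -/
theorem mul (h : Digits B ξ m D z x) (h' : Digits B ξ m' E y x') :
    Digits B ξ (m + m') (m * (D * E)) (z * y) (x * x') := by
  obtain ⟨d, hd, rfl, rfl⟩ := h
  have := sum (B := B) (ξ := ξ) (m := m + m') (D := D * E) (Finset.range m)
    (z := fun i => d i * (B ^ i * y)) (x := fun i => (d i : R) * (ξ ^ i * x')) fun i hi =>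
      ((h'.shift i).natCast_mul (d i)).mono
        (Nat.add_le_add_right (Finset.mem_range.1 hi).le _) (Nat.mul_le_mul_right _ (hd i))
  simpa [Finset.sum_mul, mul_assoc] using this

theorem lt_pow (h : Digits B ξ m D z x) (hB : D < B) : z < B ^ m := by
  obtain ⟨d, hd, rfl, -⟩ := h
  clear x
  induction m with
  | zero => simp
  | succ m ih =>
    rw [Finset.sum_range_succ, pow_succ]
    have h1 : d m * B ^ m ≤ (B - 1) * B ^ m :=
      Nat.mul_le_mul_right _ ((hd m).trans (Nat.le_sub_one_of_lt hB))
    have h2 : B ^ m * B = (B - 1) * B ^ m + B ^ m := by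
      obtain ⟨b, rfl⟩ : ∃ b, B = b + 1 := ⟨B - 1, by omega⟩
      simp
      ring
    omega

/-- Eliminating the top digit with the relation `ξ ^ s = x'`. -/
theorem reduce_top {p s Φ : ℕ} (hp : 0 < p) (hpR : (p : R) = 0) (hΦ : Digits B ξ s p Φ (ξ ^ s))
    (h : Digits B ξ (m + s + 1) D z x) (hB : D < B) :
    Digits B ξ (m + s) (D + p * p)
      (z % (B ^ m * B ^ s) + z / (B ^ m * B ^ s) % p * Φ * B ^ m) x := by
  obtain ⟨d, hd, rfl, rfl⟩ := h
  have hlow : Digits B ξ (m + s) D (∑ i ∈ Finset.range (m + s), d i * B ^ i)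
      (∑ i ∈ Finset.range (m + s), (d i : R) * ξ ^ i) := ⟨d, hd, rfl, rfl⟩
  have hlt := hlow.lt_pow hB
  rw [← pow_add, Finset.sum_range_succ, Finset.sum_range_succ, Nat.add_mul_mod_self_right,
    Nat.mod_eq_of_lt hlt, Nat.add_mul_div_right _ _ (by omega), Nat.div_eq_of_lt hlt, zero_add]
  -- Reducing the top digit mod p first limits the growth of the other digits to p·p per
  -- elimination.
  have h1 := ((hΦ.shift m).natCast_mul (d (m + s) % p)).mono le_rfl
    (Nat.mul_le_mul_right p (Nat.mod_lt _ hp).le)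
  have h2 : ((d (m + s) % p : ℕ) : R) = d (m + s) := by
    conv_rhs => rw [← Nat.mod_add_div (d (m + s)) p]
    simp [hpR]
  have h3 := hlow.add h1
  rw [h2, ← pow_add] at h3
  convert h3 using 1
  ring

theorem const (hm : 0 < m) (n : ℕ) : Digits B ξ m n n (n : R) := by
  refine mono (m := 1) ⟨fun _ => n, fun _ => le_rfl, ?_, ?_⟩ hm le_rfl <;> simp

end Digits

theorem sum_digits_mod {B : ℕ} {n : ℕ} {d : ℕ → ℕ} (h : d 0 < B) :
    (∑ i ∈ Finset.range (n + 1), d i * B ^ i) % B = d 0 := by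
  have : ∑ i ∈ Finset.range (n + 1), d i * B ^ i =
      d 0 + (∑ i ∈ Finset.range n, d (i + 1) * B ^ i) * B := by
    rw [Finset.sum_range_succ', Finset.sum_mul, add_comm]
    simp [pow_succ, mul_assoc]
  rw [this, Nat.add_mul_mod_self_right, Nat.mod_eq_of_lt h]

theorem sum_digits_div {B : ℕ} {n : ℕ} {d : ℕ → ℕ} (h : d 0 < B) :
    (∑ i ∈ Finset.range (n + 1), d i * B ^ i) / B = ∑ i ∈ Finset.range n, d (i + 1) * B ^ i := by
  have : ∑ i ∈ Finset.range (n + 1), d i * B ^ i =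
      d 0 + (∑ i ∈ Finset.range n, d (i + 1) * B ^ i) * B := by
    rw [Finset.sum_range_succ', Finset.sum_mul, add_comm]
    simp [pow_succ, mul_assoc]
  rw [this, Nat.add_mul_div_right _ _ (by omega), Nat.div_eq_of_lt h, zero_add]

/-! ### Canonical packed representatives in 𝔽_p[ξ]/(φ). -/

section AdjoinRoot

variable {p : ℕ} [Fact p.Prime] {φ : (ZMod p)[X]} (hφ : φ.Monic)

/-- The coordinate vector of `x`, read as the digits of a number in base `B`. -/
noncomputable def enc (B : ℕ) (x : AdjoinRoot φ) : ℕ :=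
  ∑ i ∈ Finset.range φ.natDegree, ((AdjoinRoot.modByMonicHom hφ x).coeff i).val * B ^ i

theorem natCast_adjoinRoot : (p : AdjoinRoot φ) = 0 := by
  rw [← map_natCast (AdjoinRoot.of φ), CharP.cast_eq_zero, map_zero]

theorem mk_sum_range {n : ℕ} (c : ℕ → ZMod p) :
    AdjoinRoot.mk φ (∑ i ∈ Finset.range n, C (c i) * X ^ i) =
      ∑ i ∈ Finset.range n, ((c i).val : AdjoinRoot φ) * AdjoinRoot.root φ ^ i := by
  rw [map_sum]
  refine Finset.sum_congr rfl fun i _ => ?_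
  rw [map_mul, map_pow, AdjoinRoot.mk_X, AdjoinRoot.mk_C, ← map_natCast (AdjoinRoot.of φ),
    ZMod.natCast_zmod_val]

theorem degree_modByMonicHom_lt (x : AdjoinRoot φ) :
    (AdjoinRoot.modByMonicHom hφ x).degree < φ.degree := by
  obtain ⟨f, rfl⟩ := AdjoinRoot.mk_surjective x
  rw [AdjoinRoot.modByMonicHom_mk]
  exact degree_modByMonic_lt f hφ

theorem digits_enc (B : ℕ) (x : AdjoinRoot φ) :
    Digits B (AdjoinRoot.root φ) φ.natDegree p (enc hφ B x) x := by
  refine ⟨_, fun i => (ZMod.val_lt ((AdjoinRoot.modByMonicHom hφ x).coeff i)).le, rfl, ?_⟩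
  rw [← mk_sum_range]
  have hdeg := degree_modByMonicHom_lt hφ x
  conv_lhs => rw [← AdjoinRoot.mk_leftInverse hφ x]
  congr 1
  by_cases h0 : AdjoinRoot.modByMonicHom hφ x = 0
  · simp [h0]
  · simp only [C_mul_X_pow_eq_monomial]
    exact as_sum_range' _ _ (natDegree_lt_natDegree h0 hdeg)

/-- A polynomial of degree less than deg φ is its own remainder, so digits below p can only be the
canonical coordinates. -/
theorem enc_eq_of_digits (B : ℕ) {d : ℕ → ℕ} (hd : ∀ i, d i < p) {x : AdjoinRoot φ}
    (hx : x = ∑ i ∈ Finset.range φ.natDegree, (d i : AdjoinRoot φ) * AdjoinRoot.root φ ^ i) :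
    enc hφ B x = ∑ i ∈ Finset.range φ.natDegree, d i * B ^ i := by
  have h1 : x = AdjoinRoot.mk φ
      (∑ i ∈ Finset.range φ.natDegree, C (d i : ZMod p) * X ^ i) := by
    rw [mk_sum_range, hx]
    exact Finset.sum_congr rfl fun i _ => by rw [ZMod.val_natCast_of_lt (hd i)]
  have h2 : AdjoinRoot.modByMonicHom hφ x =
      ∑ i ∈ Finset.range φ.natDegree, C (d i : ZMod p) * X ^ i := by
    rw [h1, AdjoinRoot.modByMonicHom_mk]
    refine (modByMonic_eq_self_iff hφ).2 ?_
    rw [degree_eq_natDegree hφ.ne_zero, ← mem_degreeLT]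
    refine Submodule.sum_mem _ fun i hi => mem_degreeLT.2 ?_
    refine (degree_C_mul_X_pow_le _ _).trans_lt ?_
    exact_mod_cast Finset.mem_range.1 hi
  refine Finset.sum_congr rfl fun i hi => ?_
  rw [h2, finsetSum_coeff]
  simp only [coeff_C_mul_X_pow, Finset.sum_ite_eq]
  rw [if_pos hi, ZMod.val_natCast_of_lt (hd i)]

theorem enc_zero (B : ℕ) : enc hφ B (0 : AdjoinRoot φ) = 0 := by simp [enc]

theorem enc_one (hs : 0 < φ.natDegree) (B : ℕ) : enc hφ B (1 : AdjoinRoot φ) = 1 := by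
  have hp := (Fact.out : p.Prime).one_lt
  rw [enc_eq_of_digits hφ B (d := fun i => if i = 0 then 1 else 0)]
  · simp [hs.ne']
  · intro i
    split_ifs <;> omega
  · simp [hs.ne']

theorem enc_eq_zero_iff {B : ℕ} (hB : 0 < B) {x : AdjoinRoot φ} : enc hφ B x = 0 ↔ x = 0 := by
  refine ⟨fun h => ?_, fun h => h ▸ enc_zero hφ B⟩
  obtain ⟨d, -, h1, rfl⟩ := digits_enc hφ B x
  rw [h, eq_comm, Finset.sum_eq_zero_iff] at h1
  refine Finset.sum_eq_zero fun i hi => ?_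
  have h2 := (mul_eq_zero.1 (h1 i hi)).resolve_right (pow_pos hB i).ne'
  rw [h2, Nat.cast_zero, zero_mul]

/-- φ(ξ) = 0 expresses ξ^s through the negated coefficients, written as p - c to remain natural. For
c = 0 this digit is p itself, which is why the digit bound is p and not p - 1. -/
theorem digits_relation {φ : (ZMod p)[X]} (hφ : φ.Monic) (B : ℕ) :
    Digits B (AdjoinRoot.root φ) φ.natDegree p
      (∑ i ∈ Finset.range φ.natDegree, (p - (φ.coeff i).val) * B ^ i)
      (AdjoinRoot.root φ ^ φ.natDegree) := by
  refine ⟨_, fun i => Nat.sub_le p (φ.coeff i).val, rfl, ?_⟩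
  have h := congrArg (AdjoinRoot.mk φ) hφ.as_sum
  rw [AdjoinRoot.mk_self, map_add, map_pow, AdjoinRoot.mk_X, mk_sum_range] at h
  rw [eq_neg_of_add_eq_zero_left h.symm, ← Finset.sum_neg_distrib]
  refine Finset.sum_congr rfl fun i _ => ?_
  rw [Nat.cast_sub (ZMod.val_lt _).le, natCast_adjoinRoot]
  ring

end AdjoinRoot

end Lacunary

/-! ### Notation for writing programs. -/

namespace RAM

instance (n : ℕ) : OfNat Expr n := ⟨Expr.num n⟩
instance : Add Expr := ⟨Expr.add⟩
instance : Sub Expr := ⟨Expr.sub⟩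
instance : Mul Expr := ⟨Expr.mul⟩
instance : Div Expr := ⟨Expr.div⟩
instance : Mod Expr := ⟨Expr.mod⟩

infixr:60 " ;; " => Prog.seq

/-- The content of register `0` of bank `b`. -/
def reg (b : ℕ) : Expr := Expr.cell b 0

/-- Assignment to register `0` of bank `b`. -/
def assign (b : ℕ) (e : Expr) : Prog := Prog.store b 0 e

variable (M : Mem) (e₁ e₂ : Expr)

@[simp] theorem Expr.eval_ofNat (n : ℕ) :
    (ofNat(n) : Expr).eval M = (ofNat(n) : ℕ) := rfl
@[simp] theorem Expr.eval_cell (b : ℕ) : (Expr.cell b e₁).eval M = M b (e₁.eval M) := rfl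
@[simp] theorem Expr.eval_reg (b : ℕ) : (reg b).eval M = M b 0 := rfl
@[simp] theorem Expr.eval_add : (e₁ + e₂).eval M = e₁.eval M + e₂.eval M := rfl
@[simp] theorem Expr.eval_sub : (e₁ - e₂).eval M = e₁.eval M - e₂.eval M := rfl
@[simp] theorem Expr.eval_mul : (e₁ * e₂).eval M = e₁.eval M * e₂.eval M := rfl
@[simp] theorem Expr.eval_div : (e₁ / e₂).eval M = e₁.eval M / e₂.eval M := rfl
@[simp] theorem Expr.eval_mod : (e₁ % e₂).eval M = e₁.eval M % e₂.eval M := rfl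

theorem Mem.write_apply (b i n b' i' : ℕ) :
    M.write b i n b' i' = if b' = b ∧ i' = i then n else M b' i' := rfl

theorem Mem.write_of_ne {b b' : ℕ} (h : b' ≠ b) (i n : ℕ) : M.write b i n b' = M b' := by
  funext i'
  simp [Mem.write_apply, h]

variable {M} {V : ℕ} {Q : Mem → Prop}

theorem ensures_assign {b : ℕ} {e : Expr} (hV : e.eval M ≤ V) (h : Q (M.write b 0 (e.eval M))) :
    Ensures V (assign b e) 1 M Q := ensures_store hV h

end RAM

/-! ### Horner's rule and normalisation of packed elements. -/

namespace Lacunary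

open Polynomial RAM

variable {p : ℕ} [Fact p.Prime] {φ : (ZMod p)[X]} {hφ : φ.Monic}

/-- The base in which the coordinate vectors are packed into numbers. -/
def packBase (p s : ℕ) : ℕ := 4 * (s + 1) * p * p

/-- The packed coordinate vector of an element. -/
noncomputable def code (hφ : φ.Monic) (x : AdjoinRoot φ) : ℕ :=
  enc hφ (packBase p φ.natDegree) x

/-- The digits of the value of `e` represent `x`, and are small enough for `reduceProg`. -/
def Packed (φ : (ZMod p)[X]) (z : ℕ) (x : AdjoinRoot φ) : Prop :=
  Digits (packBase p φ.natDegree) (AdjoinRoot.root φ) (2 * φ.natDegree)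
    (3 * (φ.natDegree + 1) * p * p) z x

/-- Registers: the base, the packed relation for `ξ ^ s`, and the power `B ^ s` of the base. -/
structure BaseEnv (hφ : φ.Monic) (M : Mem) : Prop where
  prime : M 0 0 = p
  deg : M 0 1 = φ.natDegree
  base : M 2 0 = packBase p φ.natDegree
  rel : M 3 0 = ∑ i ∈ Finset.range φ.natDegree,
    (p - (φ.coeff i).val) * packBase p φ.natDegree ^ i
  pow : M 4 0 = packBase p φ.natDegree ^ φ.natDegree

theorem BaseEnv.congr {M M' : Mem} (h : BaseEnv hφ M) (hM : ∀ b < 5, M' b = M b) :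
    BaseEnv hφ M' := by
  refine ⟨?_, ?_, ?_, ?_, ?_⟩ <;> rw [hM _ (by norm_num)]
  exacts [h.prime, h.deg, h.base, h.rel, h.pow]

/-- Horner's rule: register `dst` becomes the number with digits `d`, where `d` is evaluated with
the position of the digit in register `31`. -/
def hornerProg (dst : ℕ) (d : Expr) : Prog :=
  assign dst 0 ;; assign 31 (Expr.cell 0 1) ;;
  Prog.while (reg 31) (assign 31 (reg 31 - 1) ;; assign dst (reg dst * reg 2 + d))

theorem sum_digits_lt {B n : ℕ} {d : ℕ → ℕ} (hd : ∀ i < n, d i < B) :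
    ∑ i ∈ Finset.range n, d i * B ^ i < B ^ n := by
  induction n with
  | zero => simp
  | succ n ih =>
    rw [Finset.sum_range_succ, pow_succ]
    have h1 := ih fun i hi => hd i (by omega)
    have h2 : (d n + 1) * B ^ n ≤ B * B ^ n := Nat.mul_le_mul_right _ (hd n (by omega))
    rw [add_mul, one_mul] at h2
    rw [mul_comm (B ^ n)]
    omega

/-- Banks from 30 on serve as scratch space, so the hypotheses compare memories only on the banks
below 30. -/
theorem ensures_horner {V s B dst : ℕ} {d : Expr} {dig : ℕ → ℕ} {M : Mem} {Q : Mem → Prop}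
    (hs : M 0 1 = s) (hB : M 2 0 = B) (h0 : dst ≠ 0) (h2 : dst ≠ 2) (h30 : dst < 30)
    (hd : ∀ M' : Mem, (∀ b < 30, b ≠ dst → M' b = M b) → ∀ i < s, M' 31 0 = i →
      d.eval M' = dig i ∧ dig i < B)
    (hsV : s ≤ V) (hV : B ^ s ≤ V)
    (hQ : ∀ M' : Mem, (∀ b < 30,
      M' b = M.write dst 0 (∑ i ∈ Finset.range s, dig i * B ^ i) b) → Q M') :
    Ensures V (hornerProg dst d) (3 * s + 3) M Q := by
  have h31 : dst ≠ 31 := by omega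
  refine Ensures.mono (n₁ := 1 + (1 + (s * (1 + (1 + 1)) + 1))) ?_ (by omega) fun _ h => h
  refine ensures_seq (ensures_assign (by simp) ?_)
  refine ensures_seq (ensures_assign ?_ ?_)
  · simpa [Mem.write_apply, h0.symm, hs] using hsV
  have hdig : ∀ i < s, dig i < B := fun i hi => by
    refine (hd ((M.write 31 0 i).write dst 0 0) (fun b hb hb' => ?_) i hi ?_).2
    · rw [Mem.write_of_ne _ hb', Mem.write_of_ne _ (by omega)]
    · simp [Mem.write_apply, h31.symm]
  -- With i rounds left, the digits at positions i and above have been absorbed.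
  refine ensures_while (fun i M' => (∀ b < 30,
    M' b = M.write dst 0 (∑ l ∈ Finset.range (s - i), dig (i + l) * B ^ l) b) ∧ M' 31 0 = i)
    ?_ ?_ ?_ ?_
  · refine ⟨fun b hb => ?_, ?_⟩
    · rw [Mem.write_of_ne _ (by omega)]
      simp
    · simp [Mem.write_apply, h0.symm, hs]
  · rintro M' ⟨-, h⟩
    simpa using h
  · rintro i M' hi ⟨hM', hI⟩
    have hle : ∑ l ∈ Finset.range (s - i), dig (i + l) * B ^ l ≤ V := by
      refine (sum_digits_lt fun l hl => hdig _ (by omega)).le.trans (le_trans ?_ hV)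
      exact Nat.pow_le_pow_right (by have := hdig i hi; omega) (Nat.sub_le _ _)
    have hsum : (∑ l ∈ Finset.range (s - (i + 1)), dig (i + 1 + l) * B ^ l) * B + dig i =
        ∑ l ∈ Finset.range (s - i), dig (i + l) * B ^ l := by
      rw [show s - i = s - (i + 1) + 1 by omega, Finset.sum_range_succ', Finset.sum_mul]
      simp only [pow_zero, mul_one, add_zero, pow_succ, mul_assoc, add_assoc, add_comm 1]
    have hmul := hM' dst h30
    have hev := (hd (M'.write 31 0 i) (fun b hb hb' => by
      rw [Mem.write_of_ne _ (by omega), hM' b hb, Mem.write_of_ne _ hb']) i hi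
      (by simp [Mem.write_apply])).1
    refine ⟨by simp [hI], ?_⟩
    refine ensures_seq (ensures_assign ?_ ?_)
    · simp [hI]
      omega
    have hval : (reg dst * reg 2 + d).eval (M'.write 31 0 i) =
        ∑ l ∈ Finset.range (s - i), dig (i + l) * B ^ l := by
      rw [Expr.eval_add, hev, ← hsum]
      simp [Mem.write_apply, h31, hM' dst h30, hM' 2, hB, h2.symm]
    simp only [Expr.eval_sub, Expr.eval_reg, hI, Expr.eval_ofNat, Nat.add_sub_cancel]
    refine ensures_assign (hval ▸ hle) ⟨fun b hb => ?_, ?_⟩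
    · rw [hval]
      by_cases hb' : b = dst
      · subst hb'
        funext j
        simp only [Mem.write_apply, hM' b hb, true_and]
        split_ifs <;> first | rfl | omega
      · rw [Mem.write_of_ne _ hb', Mem.write_of_ne _ (by omega), hM' b hb,
          Mem.write_of_ne _ hb', Mem.write_of_ne _ hb']
    · simp [Mem.write_apply, h31.symm]
  · rintro M' ⟨hM', -⟩
    exact hQ M' (by simpa using hM')

/-- Replaces a packed element in register `30` by its code. -/
def reduceProg : Prog :=
  assign 32 (reg 4) ;; assign 31 (Expr.cell 0 1) ;;
  Prog.while (reg 31)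
    (assign 31 (reg 31 - 1) ;;
     assign 32 (reg 32 / reg 2) ;;
     assign 30 (reg 30 % (reg 32 * reg 4) + reg 30 / (reg 32 * reg 4) % reg 0 * reg 3 * reg 32)) ;;
  assign 33 0 ;; assign 31 (Expr.cell 0 1) ;;
  Prog.while (reg 31)
    (assign 31 (reg 31 - 1) ;;
     assign 33 (reg 33 + reg 30 % reg 2 % reg 0 * reg 32) ;;
     assign 32 (reg 32 * reg 2) ;;
     assign 30 (reg 30 / reg 2)) ;;
  assign 30 (reg 33)

theorem packBase_pos (s : ℕ) : 0 < packBase p s := by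
  have := (Fact.out : p.Prime).pos
  unfold packBase
  positivity

theorem lt_packBase_pow {n : ℕ} (hn : n ≠ 0) :
    φ.natDegree < packBase p φ.natDegree ^ n := by
  refine lt_of_lt_of_le ?_ (Nat.le_self_pow hn _)
  have := (Fact.out : p.Prime).pos
  unfold packBase
  have h2 : (φ.natDegree + 1) * 1 ≤ (φ.natDegree + 1) * (4 * p * p) :=
    Nat.mul_le_mul_left _ (by nlinarith)
  nlinarith

theorem ensures_reduce {V : ℕ} {M : Mem} {Q : Mem → Prop} {x : AdjoinRoot φ}
    (hE : BaseEnv hφ M) (hs : 0 < φ.natDegree)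
    (hV : packBase p φ.natDegree ^ (2 * φ.natDegree) ≤ V) (hx : Packed φ (M 30 0) x)
    (hQ : ∀ M' : Mem, (∀ b < 30, M' b = M b) → M' 30 0 = code hφ x → Q M') :
    Ensures V reduceProg (9 * φ.natDegree + 7) M Q := by
  have hp := (Fact.out : p.Prime).pos
  have hsV : φ.natDegree ≤ V :=
    (lt_packBase_pow (n := 2 * φ.natDegree) (by omega)).le.trans hV
  unfold Packed at hx
  unfold code enc at hQ
  -- The choice of the base: a packed element has digits up to 3(s + 1)p², and each of the s
  -- eliminations adds at most p².
  have hDB : 3 * (φ.natDegree + 1) * p * p + φ.natDegree * (p * p) < packBase p φ.natDegree := by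
    have : 0 < p * p := Nat.mul_pos hp hp
    rw [packBase]
    nlinarith
  have hpB : p ≤ packBase p φ.natDegree := Nat.le_mul_of_pos_left p (by positivity)
  have hrel := digits_relation hφ (packBase p φ.natDegree)
  have henc := fun d hd hxd => enc_eq_of_digits hφ (packBase p φ.natDegree) (d := d) hd (x := x) hxd
  unfold enc at henc
  have env : ∀ M' : Mem, (∀ b < 30, M' b = M b) → M' 0 0 = p ∧ M' 0 1 = φ.natDegree ∧
      M' 2 0 = packBase p φ.natDegree ∧ M' 3 0 = ∑ i ∈ Finset.range φ.natDegree,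
        (p - (φ.coeff i).val) * packBase p φ.natDegree ^ i ∧
      M' 4 0 = packBase p φ.natDegree ^ φ.natDegree := fun M' h => by
    have hE' : BaseEnv hφ M' := hE.congr fun b hb => h b (by omega)
    exact ⟨hE'.prime, hE'.deg, hE'.base, hE'.rel, hE'.pow⟩
  have hB0 : 0 < packBase p φ.natDegree := packBase_pos _
  generalize packBase p φ.natDegree = B at *
  set s := φ.natDegree with hs_def
  generalize ∑ i ∈ Finset.range s, (p - (φ.coeff i).val) * B ^ i = Φ at *
  clear_value s
  have hVp : ∀ i ≤ 2 * s, B ^ i ≤ V := fun i hi => (Nat.pow_le_pow_right hB0 hi).trans hV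
  obtain ⟨-, e1, -, -, e4⟩ := env M fun _ _ => rfl
  refine Ensures.mono (n₁ := 1 + (1 + ((s * (1 + (1 + (1 + 1))) + 1) + (1 + (1 +
    ((s * (1 + (1 + (1 + (1 + 1)))) + 1) + 1)))))) ?_ (by omega) fun _ h => h
  refine ensures_seq (ensures_assign ?_ ?_)
  · simpa [e4] using hVp s (by omega)
  refine ensures_seq (ensures_assign ?_ ?_)
  · simpa [Mem.write_apply, e1] using hsV
  -- First loop: with i rounds left the element has i + s digits, so the s top digits disappear one
  -- by one.
  refine ensures_seq (ensures_while (fun i M' => (∀ b < 30, M' b = M b) ∧ M' 31 0 = i ∧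
    M' 32 0 = B ^ i ∧ Digits B (AdjoinRoot.root φ) (i + s)
      (3 * (s + 1) * p * p + (s - i) * (p * p)) (M' 30 0) x) ?_ ?_ ?_ ?_)
  · refine ⟨fun b hb => ?_, ?_, ?_, ?_⟩
    · rw [Mem.write_of_ne _ (by omega), Mem.write_of_ne _ (by omega)]
    · simp [Mem.write_apply, e1]
    · simp [Mem.write_apply, e4]
    · simpa [Mem.write_apply, two_mul] using hx
  · rintro M' ⟨-, h, -⟩
    simpa using h
  · rintro i M' hi ⟨hM', h31, h32, h30⟩
    obtain ⟨f0, -, f2, f3, f4⟩ := env M' hM'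
    have hstep := Digits.reduce_top (m := i) hp natCast_adjoinRoot hrel
      (by rwa [show i + s + 1 = i + 1 + s by omega])
      (lt_of_le_of_lt (Nat.add_le_add_left (Nat.mul_le_mul_right _ (Nat.sub_le _ _)) _) hDB)
    rw [add_assoc, ← Nat.succ_mul, show (s - (i + 1)).succ = s - i by omega] at hstep
    have hlt := hstep.lt_pow
      (lt_of_le_of_lt (Nat.add_le_add_left (Nat.mul_le_mul_right _ (Nat.sub_le _ _)) _) hDB)
    have h32' : B ^ (i + 1) / B = B ^ i := by rw [pow_succ, Nat.mul_div_cancel _ hB0]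
    refine ⟨by simp [h31], ?_⟩
    refine ensures_seq (ensures_assign ?_ ?_)
    · simp [h31]
      omega
    refine ensures_seq (ensures_assign ?_ ?_)
    · simpa [Mem.write_apply, h32, f2, h32'] using hVp i (by omega)
    refine ensures_assign ?_ ⟨fun b hb => ?_, ?_, ?_, ?_⟩
    · simpa [Mem.write_apply, h32, f0, f2, f3, f4, h32'] using
        hlt.le.trans (hVp (i + s) (by omega))
    · rw [Mem.write_of_ne _ (by omega), Mem.write_of_ne _ (by omega),
        Mem.write_of_ne _ (by omega), hM' b hb]
    · simp [Mem.write_apply, h31]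
    · simp [Mem.write_apply, h32, f2, h32']
    · simpa [Mem.write_apply, h32, f0, f2, f3, f4, h32'] using hstep
  rintro M₁ ⟨hM₁, -, hq₁, hz₁⟩
  obtain ⟨-, g1, -, -, -⟩ := env M₁ hM₁
  rw [zero_add, Nat.sub_zero] at hz₁
  obtain ⟨d, hd, hz, hxd⟩ := hz₁
  have hdB : ∀ i, d i < B := fun i => (hd i).trans_lt hDB
  have hdp : ∀ i, d i % p < p := fun i => Nat.mod_lt _ hp
  have hacc : ∀ i ≤ s, ∑ l ∈ Finset.range i, d l % p * B ^ l ≤ V := fun i hi =>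
    (sum_digits_lt fun l _ => (hdp l).trans_le hpB).le.trans (hVp i (by omega))
  refine ensures_seq (ensures_assign (by simp) ?_)
  refine ensures_seq (ensures_assign ?_ ?_)
  · simpa [Mem.write_apply, g1] using hsV
  -- Second loop: digits are split off from the bottom, reduced mod p and collected in register 33.
  -- The first loop has left B^0 = 1 in register 32, the correct initial power.
  refine ensures_seq (ensures_while (fun i M' => (∀ b < 30, M' b = M b) ∧ M' 31 0 = i ∧
    M' 32 0 = B ^ (s - i) ∧ M' 30 0 = ∑ l ∈ Finset.range i, d (s - i + l) * B ^ l ∧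
    M' 33 0 = ∑ l ∈ Finset.range (s - i), d l % p * B ^ l) ?_ ?_ ?_ ?_)
  · refine ⟨fun b hb => ?_, ?_, ?_, ?_, ?_⟩
    · rw [Mem.write_of_ne _ (by omega), Mem.write_of_ne _ (by omega), hM₁ b hb]
    · simp [Mem.write_apply, g1]
    · simp [Mem.write_apply, hq₁]
    · simp [Mem.write_apply, hz]
    · simp [Mem.write_apply]
  · rintro M' ⟨-, h, -⟩
    simpa using h
  · rintro i M' hi ⟨hM', h31, h32, h30, h33⟩
    obtain ⟨f0, -, f2, -, -⟩ := env M' hM'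
    have hsi : s - i = s - (i + 1) + 1 := by omega
    have hmod := sum_digits_mod (n := i) (d := fun l => d (s - (i + 1) + l)) (hdB _)
    have hdiv := sum_digits_div (n := i) (d := fun l => d (s - (i + 1) + l)) (hdB _)
    rw [← h30] at hmod hdiv
    rw [add_zero] at hmod
    have hsum : M' 33 0 + M' 30 0 % B % p * M' 32 0 =
        ∑ l ∈ Finset.range (s - i), d l % p * B ^ l := by
      rw [hmod, h32, h33, hsi, Finset.sum_range_succ]
    have hpow : M' 32 0 * B = B ^ (s - i) := by rw [h32, hsi, pow_succ]
    refine ⟨by simp [h31], ?_⟩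
    refine ensures_seq (ensures_assign ?_ ?_)
    · simp [h31]
      omega
    refine ensures_seq (ensures_assign ?_ ?_)
    · simpa [Mem.write_apply, f0, f2, hsum] using hacc (s - i) (by omega)
    refine ensures_seq (ensures_assign ?_ ?_)
    · simpa [Mem.write_apply, f2, hpow] using hVp (s - i) (by omega)
    refine ensures_assign ?_ ⟨fun b hb => ?_, ?_, ?_, ?_, ?_⟩
    · simp only [Mem.write_apply, Expr.eval_div, Expr.eval_reg]
      norm_num
      refine (Nat.div_le_self _ _).trans ?_
      rw [h30]
      refine (sum_digits_lt fun l _ => hdB _).le.trans (hVp _ (by omega))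
    · rw [Mem.write_of_ne _ (by omega), Mem.write_of_ne _ (by omega),
        Mem.write_of_ne _ (by omega), Mem.write_of_ne _ (by omega), hM' b hb]
    · simp [Mem.write_apply, h31]
    · simp [Mem.write_apply, f2, hpow]
    · simp only [hsi, add_assoc, add_comm 1]
      simpa [Mem.write_apply, f2] using hdiv
    · simp [Mem.write_apply, f0, f2, hsum]
  rintro M₂ ⟨hM₂, -, -, -, h33⟩
  rw [Nat.sub_zero] at h33
  refine ensures_assign ?_ (hQ _ (fun b hb => ?_) ?_)
  · simpa [h33] using hacc s le_rfl
  · rw [Mem.write_of_ne _ (by omega), hM₂ b hb]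
  · rw [henc (fun i => d i % p) hdp ?_]
    · simp [Mem.write_apply, h33]
    · rw [hxd]
      refine Finset.sum_congr rfl fun i _ => ?_
      conv_lhs => rw [← Nat.mod_add_div (d i) p]
      simp [natCast_adjoinRoot]

end Lacunary

/-! ### Field operations, binary powering and the recurrence. -/

namespace Lacunary

open Polynomial RAM

variable {p : ℕ} [Fact p.Prime] {φ : (ZMod p)[X]} {hφ : φ.Monic}

theorem lt_packBase (s : ℕ) : 2 * p < packBase p s := by
  have := (Fact.out : p.Prime).pos
  have h : 3 * p ≤ 4 * (s + 1) * p * p := Nat.mul_le_mul_right p (by nlinarith)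
  unfold packBase
  omega

theorem digits_code (x : AdjoinRoot φ) : Digits (packBase p φ.natDegree) (AdjoinRoot.root φ)
    φ.natDegree p (code hφ x) x := digits_enc hφ _ x

theorem code_lt (x : AdjoinRoot φ) :
    code hφ x < packBase p φ.natDegree ^ φ.natDegree :=
  (digits_code x).lt_pow (by have := lt_packBase (p := p) φ.natDegree; omega)

theorem code_zero : code hφ 0 = 0 := enc_zero hφ _

theorem code_one (hs : 0 < φ.natDegree) : code hφ 1 = 1 := enc_one hφ hs _

theorem code_eq_zero_iff {x : AdjoinRoot φ} : code hφ x = 0 ↔ x = 0 :=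
  enc_eq_zero_iff hφ (packBase_pos _)

theorem code_le {V : ℕ} (hV : packBase p φ.natDegree ^ (2 * φ.natDegree) ≤ V)
    (x : AdjoinRoot φ) : code hφ x ≤ V :=
  (code_lt x).le.trans ((Nat.pow_le_pow_right (packBase_pos _) (by omega)).trans hV)

/-- Evaluates `e`, normalises the result, and stores it at address `addr` of bank `b`. -/
def storeReduced (b : ℕ) (addr e : Expr) : Prog :=
  assign 30 e ;; reduceProg ;; Prog.store b addr (reg 30)

/-- The address is evaluated after the normalisation, hence `haddr` asks that it depend only on
banks below 30. -/
theorem ensures_storeReduced {V b i : ℕ} {addr e : Expr} {M : Mem} {Q : Mem → Prop}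
    {x : AdjoinRoot φ} (hE : BaseEnv hφ M) (hs : 0 < φ.natDegree)
    (hV : packBase p φ.natDegree ^ (2 * φ.natDegree) ≤ V) (hx : Packed φ (e.eval M) x)
    (haddr : ∀ M' : Mem, (∀ b < 30, M' b = M b) → addr.eval M' = i)
    (hQ : ∀ M' : Mem, (∀ b' < 30, M' b' = M.write b i (code hφ x) b') → Q M') :
    Ensures V (storeReduced b addr e) (9 * φ.natDegree + 9) M Q := by
  have hlt : e.eval M < packBase p φ.natDegree ^ (2 * φ.natDegree) := by
    refine Digits.lt_pow hx ?_
    have := (Fact.out : p.Prime).pos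
    unfold packBase
    nlinarith [Nat.mul_pos this this]
  refine Ensures.mono (n₁ := 1 + ((9 * φ.natDegree + 7) + 1)) ?_ (by omega) fun _ h => h
  refine ensures_seq (ensures_assign (hlt.le.trans hV) ?_)
  have h30 : ∀ b < 30, M.write 30 0 (e.eval M) b = M b := fun b hb =>
    Mem.write_of_ne _ (by omega) _ _
  refine ensures_seq (ensures_reduce (hE.congr fun b hb => h30 b (by omega)) hs hV
    (x := x) (by simpa [Mem.write_apply] using hx) fun M₁ h₁ hz => ?_)
  have h₂ : ∀ b < 30, M₁ b = M b := fun b hb => (h₁ b hb).trans (h30 b hb)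
  refine ensures_store ?_ (hQ _ fun b' hb' => ?_)
  · simpa [hz] using code_le hV x
  · funext j
    simp [Mem.write_apply, haddr M₁ h₂, hz, h₂ b' hb']

/-- Binary powering: register `16` becomes the code of `w ^ β`, for the code of `w` in register `6`
and `β` in register `15`. -/
def powProg : Prog :=
  assign 16 1 ;; assign 19 (reg 6) ;; assign 20 (reg 15) ;;
  Prog.while (reg 20)
    (Prog.ite (reg 20 % 2) (storeReduced 16 0 (reg 16 * reg 19)) Prog.skip ;;
     storeReduced 19 0 (reg 19 * reg 19) ;;
     assign 20 (reg 20 / 2))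

theorem size_div_two {e : ℕ} (he : e ≠ 0) : Nat.size e = Nat.size (e / 2) + 1 := by
  conv_lhs => rw [← Nat.bit_bodd_div2 e]
  rw [Nat.size_bit (by rwa [Nat.bit_bodd_div2]), Nat.div2_val]

theorem packed_mul {z y : ℕ} {x x' : AdjoinRoot φ} {D : ℕ}
    (h : Digits (packBase p φ.natDegree) (AdjoinRoot.root φ) φ.natDegree p z x)
    (h' : Digits (packBase p φ.natDegree) (AdjoinRoot.root φ) φ.natDegree D y x') (hD : D ≤ 2 * p) :
    Digits (packBase p φ.natDegree) (AdjoinRoot.root φ) (2 * φ.natDegree)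
      (2 * φ.natDegree * p * p) (z * y) (x * x') := by
  refine (h.mul h').mono (by omega) ?_
  calc φ.natDegree * (p * D) ≤ φ.natDegree * (p * (2 * p)) := by gcongr
    _ = 2 * φ.natDegree * p * p := by ring

theorem Packed.of_mul {z y : ℕ} {x x' : AdjoinRoot φ}
    (h : Digits (packBase p φ.natDegree) (AdjoinRoot.root φ) φ.natDegree p z x)
    (h' : Digits (packBase p φ.natDegree) (AdjoinRoot.root φ) φ.natDegree p y x') :
    Packed φ (z * y) (x * x') :=
  (packed_mul h h' (by omega)).mono le_rfl
    (Nat.mul_le_mul_right _ (Nat.mul_le_mul_right _ (by omega)))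

/-- The bound in `Packed` is made for this: the product has digits up to 2sp², and the addend may
use 3p² more. -/
theorem Packed.of_mul_add {z y t D E : ℕ} {x x' x'' : AdjoinRoot φ}
    (h : Digits (packBase p φ.natDegree) (AdjoinRoot.root φ) φ.natDegree p z x)
    (h' : Digits (packBase p φ.natDegree) (AdjoinRoot.root φ) φ.natDegree D y x') (hD : D ≤ 2 * p)
    (h'' : Digits (packBase p φ.natDegree) (AdjoinRoot.root φ) φ.natDegree E t x'')
    (hE : E ≤ 3 * (p * p)) :
    Packed φ (z * y + t) (x * x' + x'') := by
  refine ((packed_mul h h' hD).add (h''.mono (by omega) hE)).mono le_rfl ?_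
  nlinarith

theorem Packed.of_digits {z D : ℕ} {x : AdjoinRoot φ}
    (h : Digits (packBase p φ.natDegree) (AdjoinRoot.root φ) φ.natDegree D z x)
    (hD : D ≤ 3 * (p * p)) : Packed φ z x :=
  h.mono (by omega) (by nlinarith)

theorem ensures_pow {V β : ℕ} {M : Mem} {Q : Mem → Prop} {w : AdjoinRoot φ}
    (hE : BaseEnv hφ M) (hs : 0 < φ.natDegree)
    (hV : packBase p φ.natDegree ^ (2 * φ.natDegree) ≤ V) (hw : M 6 0 = code hφ w)
    (hβ : M 15 0 = β) (hβV : β ≤ V)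
    (hQ : ∀ M' : Mem, (∀ b < 30, b ≠ 16 → b ≠ 19 → b ≠ 20 → M' b = M b) →
      M' 16 0 = code hφ (w ^ β) → Q M') :
    Ensures V powProg (Nat.size β * (18 * φ.natDegree + 21) + 4) M Q := by
  refine Ensures.mono (n₁ := 1 + (1 + (1 + (Nat.size β * (1 + ((1 + (9 * φ.natDegree + 9)) +
    ((9 * φ.natDegree + 9) + 1))) + 1)))) ?_ (by ring_nf; omega) fun _ h => h
  have h1V : 1 ≤ V := (Nat.one_le_pow _ _ (packBase_pos _)).trans hV
  refine ensures_seq (ensures_assign (by simpa using h1V) ?_)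
  refine ensures_seq (ensures_assign (by simpa [Mem.write_apply, hw] using code_le hV w) ?_)
  refine ensures_seq (ensures_assign (by simpa [Mem.write_apply, hβ] using hβV) ?_)
  -- The invariant of square-and-multiply, r·q^e = w^β; the number of rounds left is the binary
  -- length of e.
  refine ensures_while (fun i M' => (∀ b < 30, b ≠ 16 → b ≠ 19 → b ≠ 20 → M' b = M b) ∧
    Nat.size (M' 20 0) = i ∧ M' 20 0 ≤ V ∧ ∃ r q : AdjoinRoot φ, M' 16 0 = code hφ r ∧
      M' 19 0 = code hφ q ∧ r * q ^ (M' 20 0) = w ^ β) ?_ ?_ ?_ ?_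
  · refine ⟨fun b _ h1 h2 h3 => by simp [Mem.write_of_ne, h1, h2, h3], ?_, ?_, 1, w, ?_, ?_, ?_⟩
    · simp [Mem.write_apply, hβ]
    · simpa [Mem.write_apply, hβ] using hβV
    · simp [Mem.write_apply, code_one hs]
    · simp [Mem.write_apply, hw]
    · simp [Mem.write_apply, hβ]
  · rintro M' ⟨-, h, -⟩
    simpa [Nat.size_eq_zero] using h
  · rintro i M' hi ⟨hM', hsize, heV, r, q, hr, hq, hpow⟩
    have he : M' 20 0 ≠ 0 := by
      intro h0
      simp [h0] at hsize
    have hE' : BaseEnv hφ M' := hE.congr fun b hb =>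
      hM' b (by omega) (by omega) (by omega) (by omega)
    refine ⟨by simpa using he, ?_⟩
    -- Squaring and halving, common to odd and even e; for even e the write to register 16 changes
    -- nothing.
    have hrest : ∀ (M₁ : Mem) (r' : AdjoinRoot φ),
        (∀ b < 30, M₁ b = M'.write 16 0 (code hφ r') b) →
        r' * (q * q) ^ (M' 20 0 / 2) = w ^ β →
        Ensures V (storeReduced 19 0 (reg 19 * reg 19) ;; assign 20 (reg 20 / 2))
          ((9 * φ.natDegree + 9) + 1) M₁ fun M' =>
            (∀ b < 30, b ≠ 16 → b ≠ 19 → b ≠ 20 → M' b = M b) ∧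
            Nat.size (M' 20 0) = i ∧ M' 20 0 ≤ V ∧ ∃ r q : AdjoinRoot φ, M' 16 0 = code hφ r ∧
              M' 19 0 = code hφ q ∧ r * q ^ (M' 20 0) = w ^ β := by
      intro M₁ r' h₁ hr'
      have hE₁ : BaseEnv hφ M₁ := hE'.congr fun b hb => by
        rw [h₁ b (by omega), Mem.write_of_ne _ (by omega)]
      refine ensures_seq (ensures_storeReduced (x := q * q) (i := 0) hE₁ hs hV ?_
        (fun _ _ => by simp) fun M₂ h₂ => ?_)
      · simpa [h₁, Mem.write_apply, hq] using Packed.of_mul (digits_code q) (digits_code q)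
      have h20 : M₂ 20 0 = M' 20 0 := by simp [h₁, h₂, Mem.write_apply]
      have hdiv : M' 20 0 / 2 ≤ V := (Nat.div_le_self _ _).trans heV
      refine ensures_assign (by simpa [h20] using hdiv)
        ⟨fun b hb h1 h2 h3 => ?_, ?_, ?_, r', q * q, ?_, ?_, ?_⟩
      · rw [Mem.write_of_ne _ h3, h₂ b hb, Mem.write_of_ne _ h2, h₁ b hb, Mem.write_of_ne _ h1,
          hM' b hb h1 h2 h3]
      · have := size_div_two he
        simp [Mem.write_apply, h20]
        omega
      · simpa [Mem.write_apply, h20] using hdiv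
      · simp [Mem.write_apply, h₂, h₁]
      · simp [Mem.write_apply, h₂]
      · simpa [Mem.write_apply, h20] using hr'
    refine ensures_seq (ensures_ite (fun hodd => ?_) fun heven => ?_)
    · refine ensures_storeReduced (x := r * q) (i := 0) hE' hs hV ?_ (fun _ _ => by simp)
        fun M₁ h₁ => hrest M₁ _ h₁ ?_
      · simpa [hr, hq] using Packed.of_mul (digits_code r) (digits_code q)
      · rw [← hpow]
        have : M' 20 0 = 2 * (M' 20 0 / 2) + 1 := by
          simp at hodd
          omega
        conv_rhs => rw [this]
        ring
    · refine Ensures.mono (n₁ := 1) (ensures_skip (hrest M' r (fun b _ => ?_) ?_)) (by omega)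
        fun _ h => h
      · funext j
        by_cases h : b = 16 ∧ j = 0
        · obtain ⟨rfl, rfl⟩ := h
          simp [Mem.write_apply, hr]
        · simp [Mem.write_apply, h]
      · rw [← hpow]
        have : M' 20 0 = 2 * (M' 20 0 / 2) := by
          simp at heven
          omega
        conv_rhs => rw [this]
        ring
  · rintro M' ⟨hM', h, -, r, q, hr, -, hpow⟩
    rw [Nat.size_eq_zero] at h
    rw [h, pow_zero, mul_one] at hpow
    exact hQ M' hM' (hpow ▸ hr)

/-- The number of terms. -/
def numTerms : Expr := Expr.cell 0 (2 + 3 * Expr.cell 0 1)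

/-- The number of derivatives that are computed. -/
def numDerivs : Expr := 2 * numTerms * numTerms + 2

/-- Adds the scaled derivatives of a term to the entries of bank `11`; the first of them is in
register `16`. -/
def recurrenceProg : Prog :=
  assign 17 0 ;; assign 18 0 ;;
  Prog.while (numDerivs - reg 18)
    (storeReduced 11 (reg 18) (reg 16 + Expr.cell 11 (reg 18)) ;;
     storeReduced 21 0 ((reg 14 + reg 18 * (reg 0 - 1)) % reg 0 * reg 7 +
       (reg 15 + reg 18 * (reg 0 - 1)) % reg 0 * reg 5) ;;
     storeReduced 22 0 (reg 10 * reg 17) ;;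
     storeReduced 21 0 (reg 21 * reg 16 +
       (reg 18 * (reg 14 + reg 15 + 1 + reg 18 * (reg 0 - 1))) % reg 0 * reg 22) ;;
     assign 17 (reg 16) ;; assign 16 (reg 21) ;; assign 18 (reg 18 + 1))

theorem natCast_mod (n : ℕ) : ((n % p : ℕ) : AdjoinRoot φ) = n := by
  conv_rhs => rw [← Nat.mod_add_div n p]
  simp [natCast_adjoinRoot]

/-- Subtraction of registers is truncated, so the programs obtain α - n and the like as α + n(p - 1)
mod p. -/
theorem natCast_pred : ((p - 1 : ℕ) : AdjoinRoot φ) = -1 := by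
  rw [Nat.cast_sub (Fact.out : p.Prime).one_le, natCast_adjoinRoot]
  simp

set_option maxHeartbeats 1000000 in
theorem ensures_recurrence {V k α β : ℕ} {M : Mem} {Q : Mem → Prop} {U w : AdjoinRoot φ}
    {z S : ℕ → AdjoinRoot φ} (hE : BaseEnv hφ M) (hs : 0 < φ.natDegree)
    (hV : packBase p φ.natDegree ^ (2 * φ.natDegree) ≤ V) (hkV : 2 * k ^ 2 + 2 ≤ V)
    (hk : M 0 (2 + 3 * φ.natDegree) = k) (hU : M 5 0 = code hφ U) (hw : M 7 0 = code hφ w)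
    (hUw : M 10 0 = code hφ (U * w)) (hα : M 14 0 = α) (hβ : M 15 0 = β)
    (h0 : M 16 0 = code hφ (z 0))
    (hz : ∀ n, z (n + 1) = ((α - n) * w + (β - n) * U) * z n +
      n * (α + β + 1 - n) * (U * w * z (n - 1)))
    (hS : ∀ n < 2 * k ^ 2 + 2, M 11 n = code hφ (S n))
    (hQ : ∀ M' : Mem, (∀ b < 30, b ≠ 11 → b ≠ 16 → b ≠ 17 → b ≠ 18 → b ≠ 21 → b ≠ 22 →
      M' b = M b) → (∀ n < 2 * k ^ 2 + 2, M' 11 n = code hφ (S n + z n)) → Q M') :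
    Ensures V recurrenceProg ((2 * k ^ 2 + 2) * (36 * φ.natDegree + 40) + 3) M Q := by
  have hp := (Fact.out : p.Prime).pos
  set N := 2 * k ^ 2 + 2 with hN
  refine Ensures.mono (n₁ := 1 + (1 + (N * (1 + ((9 * φ.natDegree + 9) + ((9 * φ.natDegree + 9) +
    ((9 * φ.natDegree + 9) + ((9 * φ.natDegree + 9) + (1 + (1 + 1))))))) + 1))) ?_
    (by ring_nf; omega) fun _ h => h
  refine ensures_seq (ensures_assign (by simp) ?_)
  refine ensures_seq (ensures_assign (by simp) ?_)
  have hND : ∀ M' : Mem, M' 0 = M 0 → numDerivs.eval M' = N := fun M' h => by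
    simp [numDerivs, numTerms, h, hE.deg, hk, hN]
    ring
  -- With n = N - i, registers 16 and 17 hold z n and its predecessor y. Only n·y = n·z(n - 1) is
  -- required, which makes the initial value 0 admissible at n = 0.
  refine ensures_while (fun i M' => (∀ b < 30, b ≠ 11 → b ≠ 16 → b ≠ 17 → b ≠ 18 → b ≠ 21 →
    b ≠ 22 → M' b = M b) ∧ M' 18 0 = N - i ∧ i ≤ N ∧ M' 16 0 = code hφ (z (N - i)) ∧
      (∃ y, M' 17 0 = code hφ y ∧ ((N - i : ℕ) : AdjoinRoot φ) * y = (N - i : ℕ) * z (N - i - 1)) ∧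
      (∀ n < N, M' 11 n = code hφ (S n + if n < N - i then z n else 0))) ?_ ?_ ?_ ?_
  · refine ⟨fun b _ h1 h2 h3 h4 h5 h6 => by simp [Mem.write_of_ne, h3, h4], ?_, le_rfl, ?_,
      ⟨0, ?_, ?_⟩, fun n hn => ?_⟩
    · simp [Mem.write_apply]
    · simp [Mem.write_apply, h0]
    · simp [Mem.write_apply, code_zero]
    · simp
    · simp [Mem.write_apply, hS n hn]
  · rintro M' ⟨hM', h, -⟩
    simp [hND M' (hM' 0 (by norm_num) (by norm_num) (by norm_num) (by norm_num) (by norm_num)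
      (by norm_num) (by norm_num)), h]
  · rintro i M' hi ⟨hM', h18, -, h16, ⟨y, h17, hy⟩, h11⟩
    obtain ⟨n, hn⟩ : ∃ n, N - (i + 1) = n := ⟨_, rfl⟩
    have hn' : N - i = n + 1 := by omega
    have hnN : n < N := by omega
    rw [hn] at h18 h16 hy h11
    have hM0 : ∀ b, b = 0 ∨ b = 5 ∨ b = 7 ∨ b = 10 ∨ b = 14 ∨ b = 15 → M' b = M b := by
      intro b hb
      apply hM' <;> omega
    have hE' : BaseEnv hφ M' := hE.congr fun b hb => by apply hM' <;> omega
    refine ⟨?_, ?_⟩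
    · rw [Expr.eval_sub, hND M' (hM0 0 (by omega))]
      simp [h18]
      omega
    refine ensures_seq (ensures_storeReduced (x := z n + S n) (i := n) hE' hs hV ?_
      (fun M'' h => by simp [h 18, h18]) fun M₁ h₁ => ?_)
    · simp [h16, h18, h11 n hnN]
      exact Packed.of_digits ((digits_code _).add (digits_code _)) (by nlinarith)
    have hE₁ : BaseEnv hφ M₁ := hE'.congr fun b hb => by
      rw [h₁ b (by omega), Mem.write_of_ne _ (by omega)]
    refine ensures_seq (ensures_storeReduced (x := (α - n) * w + (β - n) * U) (i := 0) hE₁ hs hV ?_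
      (fun _ _ => by simp) fun M₂ h₂ => ?_)
    -- The scalars are reduced mod p so that each product has digits at most p·p.
    · have hd := (((digits_code (hφ := hφ) w).natCast_mul ((α + n * (p - 1)) % p)).mono le_rfl
        (Nat.mul_le_mul_right p (Nat.mod_lt _ hp).le)).add
        (((digits_code (hφ := hφ) U).natCast_mul ((β + n * (p - 1)) % p)).mono le_rfl
        (Nat.mul_le_mul_right p (Nat.mod_lt _ hp).le))
      rw [natCast_mod, natCast_mod] at hd
      push_cast [natCast_pred] at hd
      rw [mul_neg_one, ← sub_eq_add_neg, ← sub_eq_add_neg] at hd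
      simpa [h₁, Mem.write_apply, hM0, hE.prime, hU, hw, hα, hβ, h18] using
        Packed.of_digits hd (by nlinarith)
    have hE₂ : BaseEnv hφ M₂ := hE₁.congr fun b hb => by
      rw [h₂ b (by omega), Mem.write_of_ne _ (by omega)]
    refine ensures_seq (ensures_storeReduced (x := U * w * y) (i := 0) hE₂ hs hV ?_
      (fun _ _ => by simp) fun M₃ h₃ => ?_)
    · simpa [h₁, h₂, Mem.write_apply, hM0, hUw, h17] using
        Packed.of_mul (digits_code (U * w)) (digits_code y)
    have hE₃ : BaseEnv hφ M₃ := hE₂.congr fun b hb => by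
      rw [h₃ b (by omega), Mem.write_of_ne _ (by omega)]
    refine ensures_seq (ensures_storeReduced (x := z (n + 1)) (i := 0) hE₃ hs hV ?_
      (fun _ _ => by simp) fun M₄ h₄ => ?_)
    · have hd := Packed.of_mul_add (digits_code (hφ := hφ) ((α - n) * w + (β - n) * U))
        (digits_code (hφ := hφ) (z n)) (by omega)
        (((digits_code (hφ := hφ) (U * w * y)).natCast_mul
        ((n * (α + β + 1 + n * (p - 1))) % p)).mono le_rfl
        (Nat.mul_le_mul_right p (Nat.mod_lt _ hp).le)) (by nlinarith)
      rw [natCast_mod] at hd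
      push_cast [natCast_pred] at hd
      have hzn : z (n + 1) = ((α - n) * w + (β - n) * U) * z n +
          n * (α + β + 1 + n * -1) * (U * w * y) := by
        rw [hz]
        linear_combination -(α + β + 1 - n : AdjoinRoot φ) * (U * w) * hy
      rw [← hzn] at hd
      simpa [h₁, h₂, h₃, Mem.write_apply, hM0, hE.prime, hα, hβ, h18, h16] using hd
    refine ensures_seq (ensures_assign ?_ ?_)
    · simpa [h₁, h₂, h₃, h₄, Mem.write_apply, h16] using code_le hV (z n)
    refine ensures_seq (ensures_assign ?_ ?_)
    · simpa [h₁, h₂, h₃, h₄, Mem.write_apply] using code_le hV (z (n + 1))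
    refine ensures_assign ?_ ⟨fun b hb c1 c2 c3 c4 c5 c6 => ?_, ?_, by omega, ?_, ⟨z n, ?_, ?_⟩,
      fun m hm => ?_⟩
    · simp [h₁, h₂, h₃, h₄, Mem.write_apply, h18]
      omega
    · rw [Mem.write_of_ne _ c4, Mem.write_of_ne _ c2, Mem.write_of_ne _ c3, h₄ b hb,
        Mem.write_of_ne _ c5, h₃ b hb, Mem.write_of_ne _ c6, h₂ b hb, Mem.write_of_ne _ c5,
        h₁ b hb, Mem.write_of_ne _ c1, hM' b hb c1 c2 c3 c4 c5 c6]
    · simp [h₁, h₂, h₃, h₄, Mem.write_apply, h18, hn']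
    · simp [h₄, Mem.write_apply, hn']
    · simp [h₁, h₂, h₃, h₄, Mem.write_apply, h16]
    · simp [hn']
    · have h11' : M₄ 11 m = if m = n then code hφ (z n + S n) else M' 11 m := by
        simp [h₁, h₂, h₃, h₄, Mem.write_apply]
      rw [Mem.write_of_ne _ (by norm_num), Mem.write_of_ne _ (by norm_num),
        Mem.write_of_ne _ (by norm_num), h11', h11 m hm, hn']
      rcases lt_trichotomy m n with h | rfl | h
      · rw [if_neg h.ne, if_pos h, if_pos (by omega)]
      · rw [if_pos rfl, if_pos (by omega), add_comm]
      · rw [if_neg h.ne', if_neg (by omega), if_neg (by omega)]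
  · rintro M' ⟨hM', -, -, -, -, h11⟩
    refine hQ M' hM' fun n hn => ?_
    rw [h11 n hn, Nat.sub_zero, if_pos hn]

end Lacunary

/-! ### The contribution of a single term. -/

namespace Lacunary

open Polynomial RAM

variable {p : ℕ} [Fact p.Prime] {φ : (ZMod p)[X]} {hφ : φ.Monic}

/-- `inp` lists `p`, the degree and the coefficients of `φ`, and the data of a lacunary sum. -/
structure InputLayout (hφ : φ.Monic) (inp : ℕ → ℕ) (u v : AdjoinRoot φ) {k : ℕ}
    (a : Fin k → AdjoinRoot φ) (α β : Fin k → ℕ) : Prop where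
  prime : inp 0 = p
  deg : inp 1 = φ.natDegree
  rel : ∀ i < φ.natDegree, inp (2 + i) = (φ.coeff i).val
  fst : ∀ i < φ.natDegree,
    inp (2 + φ.natDegree + i) = ((AdjoinRoot.modByMonicHom hφ u).coeff i).val
  snd : ∀ i < φ.natDegree,
    inp (2 + 2 * φ.natDegree + i) = ((AdjoinRoot.modByMonicHom hφ v).coeff i).val
  num : inp (2 + 3 * φ.natDegree) = k
  coef : ∀ (j : Fin k), ∀ i < φ.natDegree, inp (3 + 3 * φ.natDegree + j * (φ.natDegree + 2) + i) =
    ((AdjoinRoot.modByMonicHom hφ (a j)).coeff i).val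
  exp₁ : ∀ j : Fin k, inp (3 + 3 * φ.natDegree + j * (φ.natDegree + 2) + φ.natDegree) = α j
  exp₂ : ∀ j : Fin k, inp (3 + 3 * φ.natDegree + j * (φ.natDegree + 2) + φ.natDegree + 1) = β j

/-- Registers: the input and the quantities that all terms share. -/
structure ParamEnv (hφ : φ.Monic) (inp : ℕ → ℕ) (U v w w' : AdjoinRoot φ) (g : ℕ) (M : Mem) :
    Prop where
  base : BaseEnv hφ M
  input : M 0 = inp
  slope : M 5 0 = code hφ U
  point : M 6 0 = code hφ w
  unit : M 7 0 = code hφ w'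
  sign : M 8 0 = g
  const : M 9 0 = code hφ v
  prod : M 10 0 = code hφ (U * w')

theorem ParamEnv.congr {inp : ℕ → ℕ} {U v w w' : AdjoinRoot φ} {g : ℕ} {M M' : Mem}
    (h : ParamEnv hφ inp U v w w' g M) (hM : ∀ b < 11, M' b = M b) :
    ParamEnv hφ inp U v w w' g M' := by
  refine ⟨h.base.congr fun b hb => hM b (by omega), ?_, ?_, ?_, ?_, ?_, ?_, ?_⟩ <;>
    rw [hM _ (by norm_num)]
  exacts [h.input, h.slope, h.point, h.unit, h.sign, h.const, h.prod]

/-- The contribution of a term to the `n`-th entry of bank `11`: its scaled derivative at the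
chosen point, or, for `p = 2`, its `n`-th coefficient. -/
noncomputable def contribution (U v w w' c a : AdjoinRoot φ) [DecidableEq (AdjoinRoot φ)]
    (α β n : ℕ) : AdjoinRoot φ :=
  if p = 2 then
    if n = 0 then a * ((1 - α : ℕ) * (β * v + (1 - β : ℕ))) else
      if n = 1 then a * (α + β * U) else 0
  else a * c ^ α * (if w = 0 then 0 ^ β else 1) *
    (w' ^ n * (derivative^[n] (term U w' α β)).coeff 0)

/-- Adds the contributions of a term for `p = 2`. -/
def termTwoProg : Prog :=
  storeReduced 21 0 (reg 15 * reg 9 + (1 - reg 15)) ;;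
  storeReduced 11 0 (reg 13 * ((1 - reg 14) * reg 21) + Expr.cell 11 0) ;;
  storeReduced 11 1 (reg 13 * (reg 14 + reg 15 * reg 5) + Expr.cell 11 1)

/-- Adds the contributions of a term for odd `p`. -/
def termOddProg : Prog :=
  powProg ;; storeReduced 16 0 ((1 + reg 14 % 2 * (reg 8 - 1)) * reg 16) ;;
  storeReduced 16 0 (reg 16 * reg 13) ;; recurrenceProg

/-- Loads the term whose index is in register `12`, and adds its contributions. -/
def termProg : Prog :=
  hornerProg 13 (Expr.cell 0
    (3 + 3 * Expr.cell 0 1 + reg 12 * (Expr.cell 0 1 + 2) + reg 31)) ;;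
  assign 14 (Expr.cell 0
    (3 + 3 * Expr.cell 0 1 + reg 12 * (Expr.cell 0 1 + 2) + Expr.cell 0 1)) ;;
  assign 15 (Expr.cell 0
    (3 + 3 * Expr.cell 0 1 + reg 12 * (Expr.cell 0 1 + 2) + Expr.cell 0 1 + 1)) ;;
  Prog.ite (reg 0 - 2) termOddProg termTwoProg

variable {inp : ℕ → ℕ} {U v w w' c a : AdjoinRoot φ} {g V k α β : ℕ} {M : Mem} {Q : Mem → Prop}
  {S : ℕ → AdjoinRoot φ} [DecidableEq (AdjoinRoot φ)]

/-- Both exponents are 0 or 1 here, so 1 - α and 1 - β act as negations and βv + (1 - β) is v^β. -/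
theorem ensures_termTwo (hE : ParamEnv hφ inp U v w w' g M) (hs : 0 < φ.natDegree)
    (hV : packBase p φ.natDegree ^ (2 * φ.natDegree) ≤ V) (hp2 : p = 2)
    (ha : M 13 0 = code hφ a) (hα : M 14 0 = α) (hβ : M 15 0 = β) (hαβ : α + β < p)
    (hS : ∀ n < 2 * k ^ 2 + 2, M 11 n = code hφ (S n))
    (hQ : ∀ M' : Mem, (∀ b < 13, b ≠ 11 → M' b = M b) →
      (∀ n < 2 * k ^ 2 + 2, M' 11 n = code hφ (S n + contribution U v w w' c a α β n)) → Q M') :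
    Ensures V termTwoProg (27 * φ.natDegree + 27) M Q := by
  refine Ensures.mono (n₁ := (9 * φ.natDegree + 9) + ((9 * φ.natDegree + 9) +
    (9 * φ.natDegree + 9))) ?_ (by omega) fun _ h => h
  have hβp : β * p ≤ 1 * p := Nat.mul_le_mul_right p (by omega)
  have hαp : (1 - α) * p ≤ 1 * p := Nat.mul_le_mul_right p (by omega)
  have hpp : p ≤ p * p := Nat.le_mul_self p
  refine ensures_seq (ensures_storeReduced (x := β * v + (1 - β : ℕ)) (i := 0) hE.base hs hV ?_
    (fun _ _ => by simp) fun M₁ h₁ => ?_)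
  · simpa [hβ, hE.const] using Packed.of_digits
      (((digits_code (hφ := hφ) v).natCast_mul β).add (Digits.const hs (1 - β))) (by omega)
  have hE₁ : ParamEnv hφ inp U v w w' g M₁ := hE.congr fun b hb => by
    rw [h₁ b (by omega), Mem.write_of_ne _ (by omega)]
  refine ensures_seq (ensures_storeReduced
    (x := a * ((1 - α : ℕ) * (β * v + (1 - β : ℕ))) + S 0) (i := 0) hE₁.base hs hV ?_
    (fun _ _ => by simp) fun M₂ h₂ => ?_)
  · simpa [h₁, Mem.write_apply, ha, hα, hS 0] using Packed.of_mul_add (digits_code (hφ := hφ) a)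
      ((digits_code (hφ := hφ) (β * v + (1 - β : ℕ))).natCast_mul (1 - α)) (by omega)
      (digits_code (hφ := hφ) (S 0)) (by omega)
  have hE₂ : ParamEnv hφ inp U v w w' g M₂ := hE₁.congr fun b hb => by
    rw [h₂ b (by omega), Mem.write_of_ne _ (by omega)]
  refine ensures_storeReduced (x := a * (α + β * U) + S 1) (i := 1) hE₂.base hs hV ?_
    (fun _ _ => by simp) fun M₃ h₃ => hQ M₃ (fun b hb hb' => ?_) fun n hn => ?_
  · simpa [h₁, h₂, Mem.write_apply, ha, hα, hβ, hS 1, hE.slope] using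
      Packed.of_mul_add (digits_code (hφ := hφ) a)
      ((Digits.const hs α).add ((digits_code (hφ := hφ) U).natCast_mul β)) (by omega)
      (digits_code (hφ := hφ) (S 1)) (by omega)
  · rw [h₃ b (by omega), Mem.write_of_ne _ hb', h₂ b (by omega), Mem.write_of_ne _ hb',
      h₁ b (by omega), Mem.write_of_ne _ (by omega)]
  · have h11 : M₃ 11 n = if n = 1 then code hφ (a * (α + β * U) + S 1) else
        if n = 0 then code hφ (a * ((1 - α : ℕ) * (β * v + (1 - β : ℕ))) + S 0) else M 11 n := by
      simp [h₁, h₂, h₃, Mem.write_apply]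
    rw [h11, contribution, if_pos hp2]
    rcases n with _ | _ | n
    · simp [add_comm]
    · simp [add_comm]
    · simp [hS _ hn]

theorem ensures_termOdd (hE : ParamEnv hφ inp U v w w' g M) (hs : 0 < φ.natDegree)
    (hV : packBase p φ.natDegree ^ (2 * φ.natDegree) ≤ V) (hkV : 2 * k ^ 2 + 2 ≤ V) (hp2 : p ≠ 2)
    (hk : inp (2 + 3 * φ.natDegree) = k) (hw' : w' = if w = 0 then 1 else w)
    (hg : (g : AdjoinRoot φ) = c) (hc : c ^ 2 = 1) (hg1 : 1 ≤ g) (hgp : g ≤ p)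
    (ha : M 13 0 = code hφ a) (hα : M 14 0 = α) (hβ : M 15 0 = β) (hαβ : α + β < p)
    (hS : ∀ n < 2 * k ^ 2 + 2, M 11 n = code hφ (S n))
    (hQ : ∀ M' : Mem, (∀ b < 13, b ≠ 11 → M' b = M b) →
      (∀ n < 2 * k ^ 2 + 2, M' 11 n = code hφ (S n + contribution U v w w' c a α β n)) → Q M') :
    Ensures V termOddProg (Nat.size p * (18 * φ.natDegree + 21) +
      (2 * k ^ 2 + 2) * (36 * φ.natDegree + 40) + 18 * φ.natDegree + 25) M Q := by
  have hsize : Nat.size β ≤ Nat.size p := Nat.size_le_size (by omega)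
  refine Ensures.mono (n₁ := (Nat.size β * (18 * φ.natDegree + 21) + 4) + ((9 * φ.natDegree + 9) +
    ((9 * φ.natDegree + 9) + ((2 * k ^ 2 + 2) * (36 * φ.natDegree + 40) + 3)))) ?_
    (by have := Nat.mul_le_mul_right (18 * φ.natDegree + 21) hsize; omega) fun _ h => h
  have hpV : p ≤ V := by
    refine le_trans ?_ hV
    refine le_trans ?_ (Nat.le_self_pow (by omega) _)
    have := lt_packBase (p := p) φ.natDegree
    omega
  refine ensures_seq (ensures_pow hE.base hs hV hE.point hβ (by omega) fun M₁ h₁ h16 => ?_)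
  have hE₁ : ParamEnv hφ inp U v w w' g M₁ := hE.congr fun b hb => by apply h₁ <;> omega
  refine ensures_seq (ensures_storeReduced (x := c ^ α * w ^ β) (i := 0) hE₁.base hs hV ?_
    (fun _ _ => by simp) fun M₂ h₂ => ?_)
  · have hn : 1 + α % 2 * (g - 1) ≤ p := by
      rcases Nat.mod_two_eq_zero_or_one α with h | h <;> rw [h] <;> omega
    -- As c² = 1, only the parity of α matters.
    have hcast : ((1 + α % 2 * (g - 1) : ℕ) : AdjoinRoot φ) = c ^ α := by
      conv_rhs => rw [← Nat.mod_add_div α 2, pow_add, pow_mul, hc, one_pow, mul_one]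
      rcases Nat.mod_two_eq_zero_or_one α with h | h
      · simp [h]
      · rw [h, one_mul, Nat.add_sub_cancel' hg1, hg, pow_one]
    have hd := (digits_code (hφ := hφ) (w ^ β)).natCast_mul (1 + α % 2 * (g - 1))
    rw [hcast] at hd
    simpa [h16, h₁, hα, hE.sign] using Packed.of_digits hd
      ((Nat.mul_le_mul_right p hn).trans (by omega))
  have hE₂ : ParamEnv hφ inp U v w w' g M₂ := hE₁.congr fun b hb => by
    rw [h₂ b (by omega), Mem.write_of_ne _ (by omega)]
  refine ensures_seq (ensures_storeReduced (x := c ^ α * w ^ β * a) (i := 0) hE₂.base hs hV ?_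
    (fun _ _ => by simp) fun M₃ h₃ => ?_)
  · simpa [h₁, h₂, Mem.write_apply, ha] using
      Packed.of_mul (digits_code (hφ := hφ) (c ^ α * w ^ β)) (digits_code (hφ := hφ) a)
  have hE₃ : ParamEnv hφ inp U v w w' g M₃ := hE₂.congr fun b hb => by
    rw [h₃ b (by omega), Mem.write_of_ne _ (by omega)]
  have hM₃ : ∀ b < 30, b ≠ 16 → b ≠ 19 → b ≠ 20 → M₃ b = M b := fun b hb h1 h2 h3 => by
    rw [h₃ b hb, Mem.write_of_ne _ h1, h₂ b hb, Mem.write_of_ne _ h1, h₁ b hb h1 h2 h3]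
  refine ensures_recurrence (k := k) (α := α) (β := β) (U := U) (w := w')
    (z := contribution U v w w' c a α β) hE₃.base hs hV hkV (by rw [hE₃.input, hk])
    hE₃.slope hE₃.unit hE₃.prod ?_ ?_ ?_ ?_ (S := S) ?_ fun M₄ h₄ h11 => hQ M₄ ?_ h11
  · rw [hM₃ 14 (by norm_num) (by norm_num) (by norm_num) (by norm_num), hα]
  · rw [hM₃ 15 (by norm_num) (by norm_num) (by norm_num) (by norm_num), hβ]
  -- The power is taken of the true w, not of w'. For w = 0 it yields the factor 0^β, while w' = 1
  -- contributes 1.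
  · have : contribution U v w w' c a α β 0 = c ^ α * w ^ β * a := by
      simp only [contribution, if_neg hp2, hw']
      by_cases h : w = 0
      · simp [h, term, coeff_zero_eq_eval_zero]
        ring
      · simp [h, term, coeff_zero_eq_eval_zero]
        ring
    simp [h₃, Mem.write_apply, this]
  -- Contributions are scaled derivatives times a factor independent of n, so they inherit the
  -- linear recurrence.
  · intro n
    have := term_recurrence U w' α β n
    simp only [contribution, if_neg hp2] at this ⊢
    linear_combination a * c ^ α * (if w = 0 then 0 ^ β else 1) * this
  · intro n hn
    rw [hM₃ 11 (by norm_num) (by norm_num) (by norm_num) (by norm_num), hS n hn]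
  · intro b hb hb'
    rw [h₄ b (by omega) hb' (by omega) (by omega) (by omega) (by omega) (by omega),
      hM₃ b (by omega) (by omega) (by omega) (by omega)]

theorem ensures_term {u : AdjoinRoot φ} {a : Fin k → AdjoinRoot φ} {α β : Fin k → ℕ}
    (hE : ParamEnv hφ inp U v w w' g M) (hL : InputLayout hφ inp u v a α β)
    (hs : 0 < φ.natDegree) (hV : packBase p φ.natDegree ^ (2 * φ.natDegree) ≤ V)
    (hkV : 2 * k ^ 2 + 2 ≤ V) (hw' : w' = if w = 0 then 1 else w)
    (hg : (g : AdjoinRoot φ) = c) (hc : c ^ 2 = 1) (hg1 : 1 ≤ g) (hgp : g ≤ p) (j : Fin k)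
    (hj : M 12 0 = j) (hαβ : α j + β j < p) (hS : ∀ n < 2 * k ^ 2 + 2, M 11 n = code hφ (S n))
    (hQ : ∀ M' : Mem, (∀ b < 13, b ≠ 11 → M' b = M b) →
      (∀ n < 2 * k ^ 2 + 2,
        M' 11 n = code hφ (S n + contribution U v w w' c (a j) (α j) (β j) n)) → Q M') :
    Ensures V termProg (Nat.size p * (18 * φ.natDegree + 21) +
      (2 * k ^ 2 + 2) * (36 * φ.natDegree + 40) + 21 * φ.natDegree + 31) M Q := by
  have h2B := lt_packBase (p := p) φ.natDegree
  have hpV : p ≤ V := by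
    refine le_trans ?_ hV
    refine le_trans ?_ (Nat.le_self_pow (by omega) _)
    omega
  have hsV : φ.natDegree ≤ V := (lt_packBase_pow (n := 2 * φ.natDegree) (by omega)).le.trans hV
  refine Ensures.mono (n₁ := (3 * φ.natDegree + 3) + (1 + (1 + (1 +
    (Nat.size p * (18 * φ.natDegree + 21) +
      (2 * k ^ 2 + 2) * (36 * φ.natDegree + 40) + 18 * φ.natDegree + 25)))))
    ?_ (by omega) fun _ h => h
  refine ensures_seq (ensures_horner
    (dig := fun i => ((AdjoinRoot.modByMonicHom hφ (a j)).coeff i).val) hE.base.deg hE.base.base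
    (by norm_num) (by norm_num) (by norm_num) (fun M' h i hi h31 => ⟨?_, ?_⟩) hsV
    ((Nat.pow_le_pow_right (packBase_pos _) (by omega)).trans hV) fun M₁ h₁ => ?_)
  · have := hL.coef j i hi
    simpa [h, hE.input, hL.deg, hj, h31] using this
  · exact (ZMod.val_lt _).trans (by omega)
  have hE₁ : ParamEnv hφ inp U v w w' g M₁ := hE.congr fun b hb => by
    rw [h₁ b (by omega), Mem.write_of_ne _ (by omega)]
  have hj₁ : M₁ 12 0 = j := by simpa [h₁, Mem.write_apply] using hj
  refine ensures_seq (ensures_assign ?_ ?_)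
  · simp only [Expr.eval_cell, Expr.eval_add, Expr.eval_mul, Expr.eval_ofNat, Expr.eval_reg,
      hE₁.input, hL.deg, hj₁, hL.exp₁ j]
    omega
  simp only [Expr.eval_cell, Expr.eval_add, Expr.eval_mul, Expr.eval_ofNat, Expr.eval_reg,
    hE₁.input, hL.deg, hj₁, hL.exp₁ j]
  have hM₂ : ∀ b, b ≠ 14 → M₁.write 14 0 (α j) b = M₁ b := fun b hb => Mem.write_of_ne _ hb _ _
  have hval : (Expr.cell 0 (3 + 3 * Expr.cell 0 1 + reg 12 * (Expr.cell 0 1 + 2) +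
      Expr.cell 0 1 + 1)).eval (M₁.write 14 0 (α j)) = β j := by
    simp only [Expr.eval_cell, Expr.eval_add, Expr.eval_mul, Expr.eval_ofNat, Expr.eval_reg,
      hM₂ 0 (by norm_num), hM₂ 12 (by norm_num), hE₁.input, hL.deg, hj₁, hL.exp₂ j]
  refine ensures_seq (ensures_assign (by rw [hval]; omega) ?_)
  rw [hval]
  generalize hM : (M₁.write 14 0 (α j)).write 15 0 (β j) = M₂
  have hM₂ : ∀ b < 13, M₂ b = M b := fun b hb => by
    rw [← hM, Mem.write_of_ne _ (by omega), Mem.write_of_ne _ (by omega), h₁ b (by omega),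
      Mem.write_of_ne _ (by omega)]
  have h13 : M₂ 13 0 = code hφ (a j) := by
    rw [← hM]
    simp [Mem.write_apply, h₁, code, enc]
  have h14 : M₂ 14 0 = α j := by simp [← hM, Mem.write_apply]
  have h15 : M₂ 15 0 = β j := by simp [← hM, Mem.write_apply]
  have hE₂ : ParamEnv hφ inp U v w w' g M₂ := hE.congr fun b hb => hM₂ b (by omega)
  have hS₂ : ∀ n < 2 * k ^ 2 + 2, M₂ 11 n = code hφ (S n) := fun n hn => by
    rw [hM₂ 11 (by norm_num), hS n hn]
  have hQ₂ : ∀ M' : Mem, (∀ b < 13, b ≠ 11 → M' b = M₂ b) →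
      (∀ n < 2 * k ^ 2 + 2,
        M' 11 n = code hφ (S n + contribution U v w w' c (a j) (α j) (β j) n)) → Q M' :=
    fun M' h h' => hQ M' (fun b hb hb' => (h b hb hb').trans (hM₂ b hb)) h'
  have hprime := (Fact.out : p.Prime).two_le
  -- The truncated difference p - 2 is nonzero exactly for odd p.
  refine ensures_ite (fun h => ?_) fun h => ?_
  · simp only [Expr.eval_sub, Expr.eval_reg, Expr.eval_ofNat, hE₂.base.prime] at h
    exact ensures_termOdd hE₂ hs hV hkV (by omega) hL.num hw' hg hc hg1 hgp h13 h14 h15 hαβ hS₂ hQ₂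
  · simp only [Expr.eval_sub, Expr.eval_reg, Expr.eval_ofNat, hE₂.base.prime] at h
    refine (ensures_termTwo hE₂ hs hV (by omega) h13 h14 h15 hαβ hS₂ hQ₂).mono ?_ fun _ h => h
    have : 1 * (36 * φ.natDegree + 40) ≤ (2 * k ^ 2 + 2) * (36 * φ.natDegree + 40) :=
      Nat.mul_le_mul_right _ (by omega)
    omega

end Lacunary

/-! ### The complete program. -/

namespace Lacunary

open Polynomial RAM

variable {p : ℕ} [Fact p.Prime] {φ : (ZMod p)[X]} {hφ : φ.Monic}
variable {inp : ℕ → ℕ} {V k : ℕ} {M : Mem} {Q : Mem → Prop} {u v : AdjoinRoot φ}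
  {a : Fin k → AdjoinRoot φ} {α β : Fin k → ℕ}

/-- Computes the base, the relation, and the codes of `u` and `v`. -/
def loadProg : Prog :=
  assign 2 (4 * (Expr.cell 0 1 + 1) * reg 0 * reg 0) ;;
  hornerProg 3 (reg 0 - Expr.cell 0 (2 + reg 31)) ;;
  hornerProg 4 (reg 2 - 1) ;; assign 4 (reg 4 + 1) ;;
  hornerProg 5 (Expr.cell 0 (2 + Expr.cell 0 1 + reg 31)) ;;
  hornerProg 9 (Expr.cell 0 (2 + 2 * Expr.cell 0 1 + reg 31))

/-- Chooses the point `1` or `-1` of expansion. -/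
def pointProg : Prog :=
  storeReduced 6 0 (reg 5 + reg 9) ;; assign 8 1 ;;
  Prog.ite (reg 6) Prog.skip
    (assign 8 (reg 0 - 1) ;; storeReduced 5 0 (reg 8 * reg 5) ;;
     storeReduced 6 0 (reg 5 + reg 9)) ;;
  assign 7 (reg 6 + (1 - reg 6)) ;; storeReduced 10 0 (reg 5 * reg 7)

/-- This lets `loadProg` obtain B^s from Horner's rule, as one more than the number all of whose
digits are B - 1. -/
theorem sum_pred_digits {B : ℕ} (hB : 0 < B) (n : ℕ) :
    ∑ i ∈ Finset.range n, (B - 1) * B ^ i + 1 = B ^ n := by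
  induction n with
  | zero => simp
  | succ n ih =>
    obtain ⟨b, rfl⟩ : ∃ b, B = b + 1 := ⟨B - 1, by omega⟩
    rw [Nat.add_sub_cancel] at ih ⊢
    rw [Finset.sum_range_succ, pow_succ, ← ih]
    ring

theorem ensures_load (hM : M 0 = inp) (hL : InputLayout hφ inp u v a α β)
    (hs : 0 < φ.natDegree) (hV : packBase p φ.natDegree ^ (2 * φ.natDegree) ≤ V)
    (hQ : ∀ M' : Mem, (∀ b < 30, b ≠ 2 → b ≠ 3 → b ≠ 4 → b ≠ 5 → b ≠ 9 → M' b = M b) →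
      BaseEnv hφ M' → M' 5 0 = code hφ u → M' 9 0 = code hφ v → Q M') :
    Ensures V loadProg (12 * φ.natDegree + 14) M Q := by
  have h2B := lt_packBase (p := p) φ.natDegree
  have hsV : φ.natDegree ≤ V := (lt_packBase_pow (n := 2 * φ.natDegree) (by omega)).le.trans hV
  have hBs : packBase p φ.natDegree ^ φ.natDegree ≤ V :=
    (Nat.pow_le_pow_right (packBase_pos _) (by omega)).trans hV
  have hB1 : packBase p φ.natDegree ≤ V := (Nat.le_self_pow (by omega) _).trans hBs
  refine Ensures.mono (n₁ := 1 + ((3 * φ.natDegree + 3) + ((3 * φ.natDegree + 3) + (1 +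
    ((3 * φ.natDegree + 3) + (3 * φ.natDegree + 3)))))) ?_ (by omega) fun _ h => h
  have hbase : (4 * (Expr.cell 0 1 + 1) * reg 0 * reg 0 : Expr).eval M =
      packBase p φ.natDegree := by
    simp [hM, hL.deg, hL.prime, packBase]
  refine ensures_seq (ensures_assign (hbase ▸ hB1) ?_)
  rw [hbase]
  generalize hM₁ : M.write 2 0 (packBase p φ.natDegree) = M₁
  have e₁ : ∀ b, b ≠ 2 → M₁ b = M b := fun b hb => by rw [← hM₁, Mem.write_of_ne _ hb]
  have b₁ : M₁ 2 0 = packBase p φ.natDegree := by simp [← hM₁, Mem.write_apply]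
  have i₁ : M₁ 0 = inp := by rw [e₁ 0 (by norm_num), hM]
  refine ensures_seq (ensures_horner (dig := fun i => p - (φ.coeff i).val) (by rw [i₁, hL.deg]) b₁
    (by norm_num) (by norm_num) (by norm_num) (fun M' h i hi h31 => ⟨?_, by omega⟩) hsV hBs
    fun M₂ h₂ => ?_)
  · simp [h, i₁, hL.prime, h31, hL.rel i hi]
  have b₂ : M₂ 2 0 = packBase p φ.natDegree := by simp [h₂, Mem.write_apply, b₁]
  have i₂ : M₂ 0 = inp := by rw [h₂ 0 (by norm_num), Mem.write_of_ne _ (by norm_num), i₁]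
  refine ensures_seq (ensures_horner (dig := fun i => packBase p φ.natDegree - 1)
    (by rw [i₂, hL.deg]) b₂ (by norm_num) (by norm_num) (by norm_num)
    (fun M' h i hi h31 => ⟨?_, by omega⟩) hsV hBs fun M₃ h₃ => ?_)
  · simp [h, b₂]
  have p₃ : M₃ 4 0 + 1 = packBase p φ.natDegree ^ φ.natDegree := by
    simp only [h₃ 4 (by norm_num), Mem.write_apply]
    exact sum_pred_digits (packBase_pos _) _
  refine ensures_seq (ensures_assign (by simpa [p₃] using hBs) ?_)
  rw [Expr.eval_add, Expr.eval_reg, Expr.eval_ofNat, p₃]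
  generalize hM₄ : M₃.write 4 0 (packBase p φ.natDegree ^ φ.natDegree) = M₄
  have e₄ : ∀ b < 30, b ≠ 4 → M₄ b = M₂ b := fun b hb hb' => by
    rw [← hM₄, Mem.write_of_ne _ hb', h₃ b hb, Mem.write_of_ne _ hb']
  have b₄ : M₄ 2 0 = packBase p φ.natDegree := by
    rw [e₄ 2 (by norm_num) (by norm_num), b₂]
  have i₄ : M₄ 0 = inp := by rw [e₄ 0 (by norm_num) (by norm_num), i₂]
  have hE₄ : BaseEnv hφ M₄ := by
    refine ⟨by rw [i₄, hL.prime], by rw [i₄, hL.deg], b₄, ?_, by simp [← hM₄, Mem.write_apply]⟩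
    simp [e₄, h₂, Mem.write_apply]
  refine ensures_seq (ensures_horner
    (dig := fun i => ((AdjoinRoot.modByMonicHom hφ u).coeff i).val) (by rw [i₄, hL.deg]) b₄
    (by norm_num) (by norm_num) (by norm_num)
    (fun M' h i hi h31 => ⟨?_, (ZMod.val_lt _).trans (by omega)⟩) hsV hBs fun M₅ h₅ => ?_)
  · simp [h, i₄, hL.deg, h31, hL.fst i hi]
  have i₅ : M₅ 0 = inp := by rw [h₅ 0 (by norm_num), Mem.write_of_ne _ (by norm_num), i₄]
  refine ensures_horner
    (dig := fun i => ((AdjoinRoot.modByMonicHom hφ v).coeff i).val) (by rw [i₅, hL.deg])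
    (B := packBase p φ.natDegree) (by simp [h₅, Mem.write_apply, b₄])
    (by norm_num) (by norm_num) (by norm_num)
    (fun M' h i hi h31 => ⟨?_, (ZMod.val_lt _).trans (by omega)⟩) hsV hBs fun M₆ h₆ =>
      hQ M₆ (fun b hb c2 c3 c4 c5 c9 => ?_) (hE₄.congr fun b hb => ?_) ?_ ?_
  · simp [h, i₅, hL.deg, h31, hL.snd i hi]
  · rw [h₆ b hb, Mem.write_of_ne _ c9, h₅ b hb, Mem.write_of_ne _ c5, e₄ b hb c4, h₂ b hb,
      Mem.write_of_ne _ c3, e₁ b c2]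
  · rw [h₆ b (by omega), Mem.write_of_ne _ (by omega), h₅ b (by omega),
      Mem.write_of_ne _ (by omega)]
  · simp [h₆, h₅, Mem.write_apply, code, enc]
  · simp [h₆, Mem.write_apply, code, enc]

variable [DecidableEq (AdjoinRoot φ)]

/-- The choice c = -1 is not tested again: if -u + v vanishes too, w' = 1 takes its place. -/
theorem ensures_point (hM : M 0 = inp) (hE : BaseEnv hφ M) (hu : M 5 0 = code hφ u)
    (hv : M 9 0 = code hφ v) (hs : 0 < φ.natDegree)
    (hV : packBase p φ.natDegree ^ (2 * φ.natDegree) ≤ V)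
    (hQ : ∀ (M' : Mem) (c : AdjoinRoot φ) (g : ℕ), (∀ b < 30, b = 0 ∨ 10 < b → M' b = M b) →
      (g : AdjoinRoot φ) = c → 1 ≤ g → g ≤ p → (c = 1 ∧ u + v ≠ 0 ∨ c = -1 ∧ u + v = 0) →
      ParamEnv hφ inp (c * u) v (c * u + v) (if c * u + v = 0 then 1 else c * u + v) g M' →
      Q M') :
    Ensures V pointProg (36 * φ.natDegree + 41) M Q := by
  have hp := (Fact.out : p.Prime).two_le
  have hpp : p ≤ p * p := Nat.le_mul_self p
  have h2B := lt_packBase (p := p) φ.natDegree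
  have hBV : packBase p φ.natDegree ≤ V := (Nat.le_self_pow (by omega) _).trans hV
  refine Ensures.mono (n₁ := (9 * φ.natDegree + 9) + (1 + ((1 + (1 + ((9 * φ.natDegree + 9) +
    (9 * φ.natDegree + 9)))) + (1 + (9 * φ.natDegree + 9))))) ?_ (by omega) fun _ h => h
  have hsum : ∀ x : AdjoinRoot φ, Packed φ (code hφ x + code hφ v) (x + v) := fun x =>
    Packed.of_digits ((digits_code x).add (digits_code v)) (by omega)
  refine ensures_seq (ensures_storeReduced (x := u + v) (i := 0) hE hs hV
    (by simpa [hu, hv] using hsum u) (fun _ _ => by simp) fun M₁ h₁ => ?_)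
  refine ensures_seq (ensures_assign (by simp; omega) ?_)
  have hrest : ∀ (M₂ : Mem) (c : AdjoinRoot φ) (g : ℕ),
      (∀ b < 30, b ≠ 5 → b ≠ 6 → b ≠ 8 → M₂ b = M b) →
      M₂ 5 0 = code hφ (c * u) → M₂ 6 0 = code hφ (c * u + v) → M₂ 8 0 = g →
      (g : AdjoinRoot φ) = c → 1 ≤ g → g ≤ p → (c = 1 ∧ u + v ≠ 0 ∨ c = -1 ∧ u + v = 0) →
      Ensures V (assign 7 (reg 6 + (1 - reg 6)) ;; storeReduced 10 0 (reg 5 * reg 7))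
        (1 + (9 * φ.natDegree + 9)) M₂ Q := by
    intro M₂ c g h₂ h5 h6 h8 hg hg1 hgp hc
    set w' : AdjoinRoot φ := if c * u + v = 0 then 1 else c * u + v with hw'
    -- Truncated subtraction replaces the code 0 by 1, the code of the unit element, and leaves
    -- other codes unchanged.
    have hval : (reg 6 + (1 - reg 6)).eval M₂ = code hφ w' := by
      simp only [Expr.eval_add, Expr.eval_sub, Expr.eval_reg, Expr.eval_ofNat, h6, hw']
      split_ifs with h0
      · rw [h0, code_zero, code_one hs]
      · have := mt (code_eq_zero_iff (hφ := hφ)).1 h0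
        omega
    refine ensures_seq (ensures_assign (hval ▸ code_le hV _) ?_)
    rw [hval]
    have hE₂ : BaseEnv hφ (M₂.write 7 0 (code hφ w')) := hE.congr fun b hb => by
      rw [Mem.write_of_ne _ (by omega), h₂ b (by omega) (by omega) (by omega) (by omega)]
    refine ensures_storeReduced (x := c * u * w') (i := 0) hE₂ hs hV ?_ (fun _ _ => by simp)
      fun M₃ h₃ => hQ M₃ c g (fun b hb hb' => ?_) hg hg1 hgp hc ⟨hE₂.congr fun b hb => ?_, ?_, ?_,
        ?_, ?_, ?_, ?_, ?_⟩
    · simpa [Mem.write_apply, h5] using Packed.of_mul (digits_code (c * u)) (digits_code w')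
    · rw [h₃ b hb, Mem.write_of_ne _ (by omega), Mem.write_of_ne _ (by omega),
        h₂ b hb (by omega) (by omega) (by omega)]
    · rw [h₃ b (by omega), Mem.write_of_ne _ (by omega)]
    · rw [h₃ 0 (by norm_num), Mem.write_of_ne _ (by norm_num), Mem.write_of_ne _ (by norm_num),
        h₂ 0 (by norm_num) (by norm_num) (by norm_num) (by norm_num), hM]
    · simp [h₃, Mem.write_apply, h5]
    · simp [h₃, Mem.write_apply, h6]
    · rw [← hw']
      simp [h₃, Mem.write_apply]
    · simp [h₃, Mem.write_apply, h8]
    · simp [h₃, Mem.write_apply, h₂, hv]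
    · rw [← hw']
      simp [h₃, Mem.write_apply]
  rw [Expr.eval_ofNat]
  generalize hM₂ : M₁.write 8 0 1 = M₂
  have e₂ : ∀ b < 30, b ≠ 6 → b ≠ 8 → M₂ b = M b := fun b hb h1 h2 => by
    rw [← hM₂, Mem.write_of_ne _ h2, h₁ b hb, Mem.write_of_ne _ h1]
  have h6 : M₂ 6 0 = code hφ (u + v) := by simp [← hM₂, Mem.write_apply, h₁]
  refine ensures_seq (ensures_ite (fun h => ?_) fun h => ?_)
  · rw [Expr.eval_reg, h6, Ne, code_eq_zero_iff] at h
    refine (ensures_skip (hrest M₂ 1 1 (fun b hb _ => e₂ b hb) ?_ ?_ ?_ ?_ le_rfl (by omega)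
      (Or.inl ⟨rfl, h⟩))).mono (by omega) fun _ h => h
    · rw [e₂ 5 (by norm_num) (by norm_num) (by norm_num), hu, one_mul]
    · rw [h6, one_mul]
    · simp [← hM₂, Mem.write_apply]
    · simp
  · rw [Expr.eval_reg, h6, code_eq_zero_iff] at h
    have hE₂ : BaseEnv hφ M₂ := hE.congr fun b hb => by apply e₂ <;> omega
    have hsub : (reg 0 - 1).eval M₂ = p - 1 := by simp [hE₂.prime]
    refine ensures_seq (ensures_assign (by rw [hsub]; omega) ?_)
    rw [hsub]
    have hE₃ : BaseEnv hφ (M₂.write 8 0 (p - 1)) := hE₂.congr fun b hb =>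
      Mem.write_of_ne _ (by omega) _ _
    refine ensures_seq (ensures_storeReduced (x := -1 * u) (i := 0) hE₃ hs hV ?_
      (fun _ _ => by simp) fun M₄ h₄ => ?_)
    · have hd := (digits_code (hφ := hφ) u).natCast_mul (p - 1)
      rw [natCast_pred] at hd
      simpa [Mem.write_apply, e₂, hu] using Packed.of_digits hd
        ((Nat.mul_le_mul_right p (Nat.sub_le p 1)).trans (by omega))
    have hE₄ : BaseEnv hφ M₄ := hE₃.congr fun b hb => by
      rw [h₄ b (by omega), Mem.write_of_ne _ (by omega)]
    refine ensures_storeReduced (x := -1 * u + v) (i := 0) hE₄ hs hV ?_ (fun _ _ => by simp)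
      fun M₅ h₅ => hrest M₅ (-1) (p - 1) (fun b hb c5 c6 c8 => ?_) ?_ ?_ ?_ natCast_pred (by omega)
        (by omega) (Or.inr ⟨rfl, h⟩)
    · simpa [h₄, Mem.write_apply, e₂, hv] using hsum (-1 * u)
    · rw [h₅ b hb, Mem.write_of_ne _ c6, h₄ b hb, Mem.write_of_ne _ c5, Mem.write_of_ne _ c8,
        e₂ b hb c6 c8]
    · simp [h₅, h₄, Mem.write_apply]
    · simp [h₅, Mem.write_apply]
    · simp [h₅, h₄, Mem.write_apply]

/-- Decides whether a lacunary sum vanishes. -/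
def zeroTestProg : Prog :=
  loadProg ;; pointProg ;; assign 12 numTerms ;;
  Prog.while (reg 12) (assign 12 (reg 12 - 1) ;; termProg) ;;
  assign 1 1 ;; assign 18 0 ;;
  Prog.while (numDerivs - reg 18)
    (Prog.ite (Expr.cell 11 (reg 18)) (assign 1 0) Prog.skip ;; assign 18 (reg 18 + 1))

theorem sum_filter_le_succ {A : Type*} [AddCommMonoid A] (f : Fin k → A) (j : Fin k) :
    ∑ l ∈ Finset.univ.filter (fun l : Fin k => (j : ℕ) ≤ l), f l =
      ∑ l ∈ Finset.univ.filter (fun l : Fin k => (j : ℕ) + 1 ≤ l), f l + f j := by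
  rw [add_comm, ← Finset.sum_insert (by simp)]
  congr 1
  ext l
  simp only [Finset.mem_filter, Finset.mem_univ, true_and, Finset.mem_insert, Fin.ext_iff]
  omega

theorem ensures_zeroTest (hM0 : M 0 = inp) (hM11 : ∀ i, M 11 i = 0)
    (hL : InputLayout hφ inp u v a α β) (hs : 0 < φ.natDegree)
    (hV : packBase p φ.natDegree ^ (2 * φ.natDegree) ≤ V) (hkV : 2 * k ^ 2 + 2 ≤ V)
    (hαβ : ∀ j, α j + β j < p)
    (hQ : ∀ (M' : Mem) (c : AdjoinRoot φ), (c = 1 ∧ u + v ≠ 0 ∨ c = -1 ∧ u + v = 0) →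
      M' 1 0 = (if ∀ n < 2 * k ^ 2 + 2, ∑ j, contribution (c * u) v (c * u + v)
        (if c * u + v = 0 then 1 else c * u + v) c (a j) (α j) (β j) n = 0 then 1 else 0) →
      Q M') :
    Ensures V zeroTestProg ((12 * φ.natDegree + 14) + (36 * φ.natDegree + 41) +
      k * (Nat.size p * (18 * φ.natDegree + 21) +
      (2 * k ^ 2 + 2) * (36 * φ.natDegree + 40) + 21 * φ.natDegree + 33) +
      (2 * k ^ 2 + 2) * 4 + 5) M Q := by
  refine Ensures.mono (n₁ := (12 * φ.natDegree + 14) + ((36 * φ.natDegree + 41) + (1 +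
      ((k * (1 + (1 + (Nat.size p * (18 * φ.natDegree + 21) +
      (2 * k ^ 2 + 2) * (36 * φ.natDegree + 40) + 21 * φ.natDegree + 31))) + 1) + (1 + (1 +
      ((2 * k ^ 2 + 2) * (1 + ((1 + 1) + 1)) + 1))))))) ?_ (by ring_nf; omega) fun _ h => h
  refine ensures_seq (ensures_load hM0 hL hs hV fun M₁ h₁ hE₁ hu₁ hv₁ => ?_)
  have hM₁0 : M₁ 0 = inp := by
    rw [h₁ 0 (by norm_num) (by norm_num) (by norm_num) (by norm_num) (by norm_num) (by norm_num),
      hM0]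
  refine ensures_seq (ensures_point hM₁0 hE₁ hu₁ hv₁ hs hV fun M₂ c g h₂ hg hg1 hgp hc hE₂ => ?_)
  have hN : ∀ M' : Mem, M' 0 = inp → numTerms.eval M' = k := fun M' h => by
    simp [numTerms, h, hL.deg, hL.num]
  have hND : ∀ M' : Mem, M' 0 = inp → numDerivs.eval M' = 2 * k ^ 2 + 2 := fun M' h => by
    simp only [numDerivs, Expr.eval_add, Expr.eval_mul, Expr.eval_ofNat, hN M' h]
    ring
  have hkV' : k ≤ V := by nlinarith
  refine ensures_seq (ensures_assign (by rw [hN M₂ hE₂.input]; exact hkV') ?_)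
  rw [hN M₂ hE₂.input]
  have hQc := fun M' => hQ M' c hc
  generalize hw : c * u + v = w at *
  generalize hw' : (if w = 0 then 1 else w) = w' at *
  generalize c * u = U at *
  have hc2 : c ^ 2 = 1 := by rcases hc with ⟨rfl, -⟩ | ⟨rfl, -⟩ <;> ring
  -- Terms are processed from the last to the first; with i rounds left, those of index at least i
  -- have been added.
  refine ensures_seq (ensures_while (fun i M' => (∀ b < 11, M' b = M₂ b) ∧ M' 12 0 = i ∧
    ∀ n < 2 * k ^ 2 + 2, M' 11 n =
      code hφ (∑ l ∈ Finset.univ.filter (fun l : Fin k => i ≤ l),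
        contribution U v w w' c (a l) (α l) (β l) n)) ?_ ?_ ?_ ?_)
  · refine ⟨fun b hb => Mem.write_of_ne _ (by omega) _ _, by simp [Mem.write_apply],
      fun n hn => ?_⟩
    rw [Finset.filter_false_of_mem fun l _ => by omega, Finset.sum_empty, code_zero,
      Mem.write_of_ne _ (by norm_num), h₂ 11 (by norm_num) (by norm_num),
      h₁ 11 (by norm_num) (by norm_num) (by norm_num) (by norm_num) (by norm_num) (by norm_num),
      hM11]
  · rintro M' ⟨-, h, -⟩
    simpa using h
  · rintro i M' hi ⟨hM', h12, h11⟩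
    refine ⟨by simp [h12], ?_⟩
    have hsub : (reg 12 - 1).eval M' = i := by simp [h12]
    refine ensures_seq (ensures_assign (by rw [hsub]; omega) ?_)
    rw [hsub]
    refine ensures_term (j := (⟨i, hi⟩ : Fin k)) (S := fun n =>
      ∑ l ∈ Finset.univ.filter (fun l : Fin k => i + 1 ≤ l),
        contribution U v w w' c (a l) (α l) (β l) n) (hE₂.congr fun b hb => ?_) hL hs hV hkV
      hw'.symm hg hc2 hg1 hgp (by simp [Mem.write_apply]) (hαβ _) (fun n hn => ?_)
      fun M₃ h₃ h11₃ => ?_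
    · rw [Mem.write_of_ne _ (by omega), hM' b hb]
    · rw [Mem.write_of_ne _ (by norm_num), h11 n hn]
    refine ⟨fun b hb => ?_, ?_, fun n hn => ?_⟩
    · rw [h₃ b (by omega) (by omega), Mem.write_of_ne _ (by omega), hM' b hb]
    · rw [h₃ 12 (by norm_num) (by norm_num)]
      simp [Mem.write_apply]
    · rw [h11₃ n hn]
      exact congrArg _ (sum_filter_le_succ
        (fun l => contribution U v w w' c (a l) (α l) (β l) n) ⟨i, hi⟩).symm
  rintro M₃ ⟨h₃, -, h11⟩
  simp only [Nat.zero_le, Finset.filter_true] at h11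
  have h1V : 1 ≤ V := by omega
  have i₃ : M₃ 0 = inp := by rw [h₃ 0 (by norm_num), hE₂.input]
  refine ensures_seq (ensures_assign (by simpa using h1V) ?_)
  refine ensures_seq (ensures_assign (by simp) ?_)
  classical
  generalize hT : (fun n => ∑ l, contribution U v w w' c (a l) (α l) (β l) n) = T at *
  replace hT : ∀ n, ∑ l, contribution U v w w' c (a l) (α l) (β l) n = T n := fun n => by
    rw [← hT]
  simp only [hT] at h11 hQc
  -- The output register tells whether all entries inspected so far are zero.
  refine ensures_while (fun i M' => M' 0 = inp ∧ M' 11 = M₃ 11 ∧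
    M' 18 0 = 2 * k ^ 2 + 2 - i ∧ i ≤ 2 * k ^ 2 + 2 ∧
    M' 1 0 = if ∀ n < 2 * k ^ 2 + 2 - i, T n = 0 then 1 else 0) ?_ ?_ ?_ ?_
  · refine ⟨?_, ?_, ?_, le_rfl, ?_⟩
    · rw [Mem.write_of_ne _ (by norm_num), Mem.write_of_ne _ (by norm_num), i₃]
    · rw [Mem.write_of_ne _ (by norm_num), Mem.write_of_ne _ (by norm_num)]
    · simp [Mem.write_apply]
    · simp [Mem.write_apply]
  · rintro M' ⟨hi, -, h, -⟩
    simp [hND M' hi, h]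
  · rintro i M' hi ⟨hi0, hi11, h18, -, hout⟩
    obtain ⟨n, hn⟩ : ∃ n, 2 * k ^ 2 + 2 - (i + 1) = n := ⟨_, rfl⟩
    have hn' : 2 * k ^ 2 + 2 - i = n + 1 := by omega
    have hnN : n < 2 * k ^ 2 + 2 := by omega
    rw [hn] at h18 hout
    refine ⟨by rw [Expr.eval_sub, hND M' hi0, Expr.eval_reg, h18]; omega, ?_⟩
    have hcell : (Expr.cell 11 (reg 18)).eval M' = code hφ (T n) := by
      simp [h18, hi11, h11 n hnN]
    have hrest : ∀ M₄ : Mem, M₄ 0 = inp → M₄ 11 = M₃ 11 → M₄ 18 0 = n →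
        M₄ 1 0 = (if ∀ m < n + 1, T m = 0 then 1 else 0) →
        Ensures V (assign 18 (reg 18 + 1)) 1 M₄ fun M' => M' 0 = inp ∧ M' 11 = M₃ 11 ∧
          M' 18 0 = 2 * k ^ 2 + 2 - i ∧ i ≤ 2 * k ^ 2 + 2 ∧
          M' 1 0 = if ∀ n < 2 * k ^ 2 + 2 - i, T n = 0 then 1 else 0 := by
      intro M₄ c0 c11 c18 c1
      rw [hn']
      refine ensures_assign (by simp [c18]; omega) ⟨?_, ?_, ?_, by omega, ?_⟩
      · rw [Mem.write_of_ne _ (by norm_num), c0]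
      · rw [Mem.write_of_ne _ (by norm_num), c11]
      · simp [Mem.write_apply, c18]
      · rw [Mem.write_of_ne _ (by norm_num), c1]
    refine ensures_seq (ensures_ite (fun h => ?_) fun h => ?_)
    · rw [hcell, Ne, code_eq_zero_iff] at h
      refine ensures_assign (by simp) (hrest _ ?_ ?_ ?_ ?_)
      · rw [Mem.write_of_ne _ (by norm_num), hi0]
      · rw [Mem.write_of_ne _ (by norm_num), hi11]
      · simp [Mem.write_apply, h18]
      · rw [if_neg fun h' => h (h' n (Nat.lt_succ_self n))]
        simp [Mem.write_apply]
    · rw [hcell, code_eq_zero_iff] at h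
      refine ensures_skip (hrest M' hi0 hi11 h18 ?_)
      rw [hout]
      simp only [Nat.lt_succ_iff_lt_or_eq, or_imp, forall_and, forall_eq, h, and_true]
  · rintro M' ⟨-, -, -, -, h⟩
    exact hQc M' (by rw [h, Nat.sub_zero])

end Lacunary

/-! ### Vanishing of P in terms of the accumulated contributions. -/

namespace Lacunary

open Polynomial RAM

section ZeroTest

variable {p : ℕ} [Fact p.Prime] {φ : (ZMod p)[X]} [Fact (Irreducible φ)]
  [DecidableEq (AdjoinRoot φ)] {k : ℕ} {a : Fin k → AdjoinRoot φ} {α β : Fin k → ℕ}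

theorem poly_two_eq (hp2 : p = 2) (u v w w' c a : AdjoinRoot φ) {α β : ℕ} (h : α + β < p) :
    C a * X ^ α * (C u * X + C v) ^ β =
      C (contribution u v w w' c a α β 0) + C (contribution u v w w' c a α β 1) * X := by
  have : (α = 0 ∧ β = 0) ∨ (α = 1 ∧ β = 0) ∨ (α = 0 ∧ β = 1) := by omega
  rcases this with ⟨rfl, rfl⟩ | ⟨rfl, rfl⟩ | ⟨rfl, rfl⟩
  · simp [contribution, hp2]
  · simp [contribution, hp2]
  · simp [contribution, hp2]
    ring

/-- The expansion point moves to c, so that X^α becomes c^α(1 + X)^α and uX + v becomes w + cuX. If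
w = 0, then u = 0 and the second factor is the constant 0^β. -/
theorem poly_comp_eq {u v w c : AdjoinRoot φ} (hw : w = c * u + v)
    (h0 : w = 0 → u = 0) (b : AdjoinRoot φ) (α β : ℕ) :
    (C b * X ^ α * (C u * X + C v) ^ β).comp (C c * (1 + X)) =
      C (b * c ^ α * (if w = 0 then 0 ^ β else 1)) *
        term (c * u) (if w = 0 then 1 else w) α β := by
  have h1 : (C u * X + C v).comp (C c * (1 + X)) = C w + C (c * u) * X := by
    simp [hw]
    ring
  rw [mul_comp, pow_comp, mul_comp, pow_comp, h1, C_comp, X_comp, term, mul_pow]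
  by_cases h : w = 0
  · simp [h, h0 h]
    ring
  · simp [h]
    ring

theorem poly_eq_zero_iff {u v w c : AdjoinRoot φ} (hw : w = c * u + v)
    (hc : c = 1 ∧ u + v ≠ 0 ∨ c = -1 ∧ u + v = 0) (hαβ : ∀ j, α j + β j < p) :
    poly u v a α β = 0 ↔ ∀ n < 2 * k ^ 2 + 2,
      ∑ j, contribution (c * u) v w (if w = 0 then 1 else w) c (a j) (α j) (β j) n = 0 := by
  have hchar : CharP (AdjoinRoot φ) p := charP_of_injective_algebraMap
    (algebraMap (ZMod p) (AdjoinRoot φ)).injective p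
  have hcc : c * c = 1 := by rcases hc with ⟨rfl, -⟩ | ⟨rfl, -⟩ <;> ring
  by_cases hp2 : p = 2
  · have hc1 : c = 1 := by
      rcases hc with ⟨rfl, -⟩ | ⟨rfl, -⟩
      · rfl
      -- In characteristic 2 the alternatives coincide, as -1 = 1.
      · have : ((2 : ℕ) : AdjoinRoot φ) = 0 := by
          rw [CharP.cast_eq_zero_iff (AdjoinRoot φ) p, hp2]
        push_cast at this
        linear_combination -this
    have hpoly : poly u v a α β =
        C (∑ j, contribution (c * u) v w (if w = 0 then 1 else w) c (a j) (α j) (β j) 0) +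
        C (∑ j, contribution (c * u) v w (if w = 0 then 1 else w) c (a j) (α j) (β j) 1) * X := by
      rw [map_sum, map_sum, Finset.sum_mul, ← Finset.sum_add_distrib, poly]
      refine Finset.sum_congr rfl fun j _ => ?_
      rw [← poly_two_eq hp2 _ _ _ _ _ _ (hαβ j), hc1, one_mul]
    rw [hpoly]
    constructor
    · intro h n _
      have h0 := congrArg (fun f => f.coeff 0) h
      have h1 := congrArg (fun f => f.coeff 1) h
      simp only [coeff_add, coeff_C_zero, coeff_C_mul, coeff_X_zero, mul_zero, add_zero,
        coeff_zero, coeff_X_one, mul_one, coeff_C_succ, zero_add] at h0 h1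
      rcases n with _ | _ | n
      · exact h0
      · simpa [coeff_C] using h1
      · exact Finset.sum_eq_zero fun j _ => by simp [contribution, hp2]
    · intro h
      rw [h 0 (by omega), h 1 (by omega)]
      simp
  -- w = 0 is possible only for c = -1; then u + v = 0 = -u + v, so 2u = 0 with 2 invertible.
  · have h0 : w = 0 → u = 0 := by
      intro h0
      rcases hc with ⟨rfl, h⟩ | ⟨rfl, h⟩
      · exact absurd (by rw [← h0, hw, one_mul]) h
      · have h2 : ((2 : ℕ) : AdjoinRoot φ) * u = 0 := by
          push_cast
          linear_combination h - h0 + hw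
        refine (mul_eq_zero.1 h2).resolve_left ?_
        rw [CharP.cast_eq_zero_iff (AdjoinRoot φ) p,
          Nat.prime_dvd_prime_iff_eq (Fact.out : p.Prime) Nat.prime_two]
        exact hp2
    have hcomp : (poly u v a α β).comp (C c * (1 + X)) =
        ∑ j, C (a j * c ^ α j * (if w = 0 then 0 ^ β j else 1)) *
          term (c * u) (if w = 0 then 1 else w) (α j) (β j) := by
      rw [poly, Polynomial.sum_comp]
      exact Finset.sum_congr rfl fun j _ => poly_comp_eq hw h0 _ _ _
    have hzero : poly u v a α β = 0 ↔ (poly u v a α β).comp (C c * (1 + X)) = 0 := by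
      refine ⟨fun h => by rw [h, zero_comp], fun h => ?_⟩
      -- The substitution is invertible because c² = 1.
      have hX : (C c * (1 + X)).comp (C c * X - 1) = (X : (AdjoinRoot φ)[X]) := by
        simp [← mul_assoc, ← C_mul, hcc]
      rw [← comp_X (p := poly u v a α β), ← hX, ← comp_assoc, h, zero_comp]
    have hw' : (if w = 0 then 1 else w) ≠ 0 := by
      split_ifs with h
      · exact one_ne_zero
      · exact h
    rw [hzero, hcomp, sum_term_eq_zero_iff hw' hαβ _ (N := 2 * k ^ 2 + 2) (by omega)]
    simp only [contribution, if_neg hp2]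

end ZeroTest

/-! ### Positions of the data in the encoded input. -/

theorem getD_append_add {l l' : List ℕ} {m : ℕ} (h : l.length = m) (i : ℕ) :
    (l ++ l').getD (m + i) 0 = l'.getD i 0 := by
  subst h
  rw [List.getD_append_right _ _ _ _ (by omega), Nat.add_sub_cancel_left]

theorem getD_flatten_ofFn {k L : ℕ} (f : Fin k → List ℕ) (hf : ∀ j, (f j).length = L) (j : Fin k)
    {i : ℕ} (hi : i < L) : (List.ofFn f).flatten.getD (j * L + i) 0 = (f j).getD i 0 := by
  induction k with
  | zero => exact j.elim0
  | succ k ih =>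
    rw [List.ofFn_succ, List.flatten_cons]
    refine Fin.cases ?_ (fun j => ?_) j
    · rw [List.getD_append _ _ _ _ (by rw [hf]; simpa using hi)]
      simp
    · rw [show ((j.succ : Fin (k + 1)) : ℕ) * L + i = L + (j * L + i) by simp; ring,
        getD_append_add (hf 0), ih (fun j => f j.succ) (fun j => hf _) j]

section Encode

variable {p : ℕ} [Fact p.Prime] {φ : (ZMod p)[X]} (hφ : φ.Monic) (u v : AdjoinRoot φ) {k : ℕ}
  (a : Fin k → AdjoinRoot φ) (α β : Fin k → ℕ)

theorem length_coeffs (s : ℕ) (f : (ZMod p)[X]) : (coeffs s f).length = s := by simp [coeffs]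

theorem length_coords (x : AdjoinRoot φ) : (coords hφ x).length = φ.natDegree :=
  length_coeffs _ _

theorem getD_coeffs {s i : ℕ} (f : (ZMod p)[X]) (hi : i < s) :
    (coeffs s f).getD i 0 = (f.coeff i).val := by
  rw [List.getD_eq_getElem _ _ (by rwa [length_coeffs])]
  simp [coeffs]

theorem inputLayout_encode :
    InputLayout hφ (fun i => (encode hφ u v a α β).getD i 0) u v a α β := by
  set s := φ.natDegree with hs
  have hlen : ∀ j, (coords hφ (a j) ++ [α j, β j]).length = s + 2 := fun j => by
    simp [length_coords, hs]
  have hc := length_coeffs φ.natDegree φ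
  have hu := length_coords hφ u
  have hv := length_coords hφ v
  have h1 : ([p, φ.natDegree] ++ coeffs φ.natDegree φ).length = 2 + s := by
    simp [hc]
    omega
  have h2 : ([p, φ.natDegree] ++ coeffs φ.natDegree φ ++ coords hφ u).length = 2 + 2 * s := by
    simp [hc, hu]
    omega
  have h3 : ([p, φ.natDegree] ++ coeffs φ.natDegree φ ++ coords hφ u ++ coords hφ v).length =
      2 + 3 * s := by
    simp [hc, hu, hv]
    omega
  have h4 : ([p, φ.natDegree] ++ coeffs φ.natDegree φ ++ coords hφ u ++ coords hφ v ++
      [k]).length = 3 + 3 * s := by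
    simp [hc, hu, hv]
    omega
  have hterm : ∀ (j : Fin k) (i : ℕ), i < s + 2 →
      (encode hφ u v a α β).getD (3 + 3 * s + j * (s + 2) + i) 0 =
        (coords hφ (a j) ++ [α j, β j]).getD i 0 := fun j i hi => by
    rw [encode, add_assoc, getD_append_add h4, getD_flatten_ofFn _ hlen j hi]
  refine ⟨?_, ?_, fun i hi => ?_, fun i hi => ?_, fun i hi => ?_, ?_, fun j i hi => ?_,
    fun j => ?_, fun j => ?_⟩
  · simp [encode]
  · simp [encode]
  · simp only [encode, List.append_assoc]
    rw [getD_append_add (l := [p, φ.natDegree]) (m := 2) rfl, List.getD_append _ _ _ _ (by omega), getD_coeffs _ hi]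
  · simp only [encode]
    rw [List.append_assoc, List.append_assoc, List.append_assoc, getD_append_add h1,
      List.getD_append _ _ _ _ (by omega), coords, getD_coeffs _ hi]
  · simp only [encode]
    rw [List.append_assoc, List.append_assoc, getD_append_add h2,
      List.getD_append _ _ _ _ (by omega), coords, getD_coeffs _ hi]
  · simp only [encode]
    rw [List.append_assoc]
    exact (getD_append_add h3 0).trans (by simp)
  · rw [hterm j i (by omega), List.getD_append _ _ _ _ (by rwa [length_coords]), coords,
      getD_coeffs _ hi]
  · rw [hterm j s (by omega)]
    exact (getD_append_add (length_coords hφ (a j)) 0).trans (by simp)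
  · rw [add_assoc, hterm j (s + 1) (by omega)]
    exact (getD_append_add (length_coords hφ (a j)) 1).trans (by simp)

end Encode

/-! ### Polynomial bounds in the input size, and the conclusion. -/

theorem length_le_inputSize (x : List ℕ) : x.length ≤ inputSize x := by
  induction x with
  | nil => simp
  | cons n x ih =>
    have := len_pos n
    simp only [inputSize, List.map_cons, List.sum_cons, List.length_cons] at ih ⊢
    omega

theorem len_le_inputSize {x : List ℕ} {n : ℕ} (h : n ∈ x) : len n ≤ inputSize x :=
  List.single_le_sum (by simp) _ (List.mem_map_of_mem h)

theorem size_le_inputSize {x : List ℕ} (i : ℕ) : Nat.size (x.getD i 0) ≤ inputSize x := by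
  by_cases h : i < x.length
  · rw [List.getD_eq_getElem _ _ h]
    have := len_le_inputSize (List.getElem_mem h)
    unfold len at this
    omega
  · rw [List.getD_eq_default _ _ (not_lt.1 h)]
    simp

/-- A bound for the number of elementary steps of `zeroTestProg` on inputs of size `L`. -/
def stepBound (L : ℕ) : ℕ :=
  (12 * L + 14) + (36 * L + 41) +
    L * (L * (18 * L + 21) + (2 * L ^ 2 + 2) * (36 * L + 40) + 21 * L + 33) +
    (2 * L ^ 2 + 2) * 4 + 5

/-- A bound for the lengths of all registers on inputs of size `L`. -/
def lenBound (L : ℕ) : ℕ := 8 * L ^ 2 + 15 * L + 8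

theorem len_registers_le {s k p L : ℕ} (hs : s ≤ L) (hk : k ≤ L) (hp : len p ≤ L) :
    len (packBase p s ^ (2 * s) * (2 * k ^ 2 + 2) * 2 ^ L) ≤ lenBound L := by
  have h1 := len_mul_le (packBase p s ^ (2 * s) * (2 * k ^ 2 + 2)) (2 ^ L)
  have h2 := len_mul_le (packBase p s ^ (2 * s)) (2 * k ^ 2 + 2)
  have h3 := len_pow_le (packBase p s) (2 * s)
  have h4 := len_le_succ (2 * k ^ 2 + 2)
  have h5 := len_pow_le 2 L
  have h6 := len_mul_le (4 * (s + 1) * p) p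
  have h7 := len_mul_le (4 * (s + 1)) p
  have h8 := len_mul_le 4 (s + 1)
  have h9 := len_le_succ (s + 1)
  have h10 : len 4 = 4 := by decide
  have h11 : len 2 = 3 := by decide
  have h12 : len (packBase p s) ≤ 3 * L + 6 := by
    unfold packBase
    omega
  have h13 : 2 * s * len (packBase p s) ≤ 2 * L * (3 * L + 6) :=
    Nat.mul_le_mul (by omega) h12
  have h14 : k ^ 2 ≤ L ^ 2 := Nat.pow_le_pow_left hk 2
  rw [h11] at h5
  have h15 : lenBound L = 2 * L * (3 * L + 6) + 2 * L ^ 2 + 3 * L + 8 := by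
    unfold lenBound
    ring
  omega

end Lacunary

theorem mainTheorem12 :
    ∃ (A : RAM.Prog) (q : Polynomial ℕ),
      ∀ (p : ℕ) (_ : p.Prime) (φ : Polynomial (ZMod p)) (hφ : φ.Monic) (_ : Irreducible φ)
        (u v : AdjoinRoot φ) (k : ℕ) (a : Fin k → AdjoinRoot φ) (α β : Fin k → ℕ),
        (∀ j, α j + β j < p) →
        ∃ t y : ℕ,
          RAM.Outputs A (Lacunary.encode hφ u v a α β) t y ∧
          t ≤ q.eval (RAM.inputSize (Lacunary.encode hφ u v a α β)) ∧
          (y = 1 ↔ Lacunary.poly u v a α β = 0) ∧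
          (y = 0 ↔ Lacunary.poly u v a α β ≠ 0) := by
  classical
  obtain ⟨q, hq⟩ : ∃ q : Polynomial ℕ, ∀ L, q.eval L = Lacunary.stepBound L *
      (Lacunary.zeroTestProg.stepCoeff * Lacunary.lenBound L ^ 2) := by
    let x : Polynomial ℕ := Polynomial.X
    refine ⟨((12 * x + 14) + (36 * x + 41) +
      x * (x * (18 * x + 21) + (2 * x ^ 2 + 2) * (36 * x + 40) + 21 * x + 33) +
      (2 * x ^ 2 + 2) * 4 + 5) *
      (Polynomial.C Lacunary.zeroTestProg.stepCoeff * (8 * x ^ 2 + 15 * x + 8) ^ 2), fun L => ?_⟩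
    simp [x, Lacunary.stepBound, Lacunary.lenBound]
  refine ⟨Lacunary.zeroTestProg, q, ?_⟩
  intro p hp φ hφ hirr u v k a α β hαβ
  have := Fact.mk hp
  have := Fact.mk hirr
  have hL := Lacunary.inputLayout_encode hφ u v a α β
  set x := Lacunary.encode hφ u v a α β with hx
  obtain ⟨L, hLdef⟩ : ∃ L, RAM.inputSize x = L := ⟨_, rfl⟩
  rw [hLdef]
  have hs : 0 < φ.natDegree := hirr.natDegree_pos
  -- All coordinates and all terms are listed, so s and k themselves, not only their lengths, are at
  -- most L; of p only the length is.
  have hlen : x.length = 3 + 3 * φ.natDegree + k * (φ.natDegree + 2) := by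
    rw [hx]
    simp [Lacunary.encode, Lacunary.length_coeffs, Lacunary.length_coords, Function.comp_def,
      List.length_flatten]
    ring
  have hxL := Lacunary.length_le_inputSize x
  rw [hLdef] at hxL
  have hsL : φ.natDegree ≤ L := by omega
  have hkL : k ≤ L := by nlinarith
  have hpL : RAM.len p ≤ L := hLdef ▸ Lacunary.len_le_inputSize (by simp [hx, Lacunary.encode])
  -- The three factors dominate the packed elements, the number of derivatives, and the input
  -- numbers, respectively.
  obtain ⟨V, hV⟩ : ∃ V, V = Lacunary.packBase p φ.natDegree ^ (2 * φ.natDegree) *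
    (2 * k ^ 2 + 2) * 2 ^ L := ⟨_, rfl⟩
  have hlenV := Lacunary.len_registers_le hsL hkL hpL
  rw [← hV] at hlenV
  have hBpos : 0 < Lacunary.packBase p φ.natDegree ^ (2 * φ.natDegree) :=
    pow_pos (Lacunary.packBase_pos _) _
  have hbdd : RAM.Bdd V (RAM.init x) := by
    intro b i
    unfold RAM.init
    split_ifs
    · refine (Nat.size_le.1 (Lacunary.size_le_inputSize i)).le.trans ?_
      rw [hV, hLdef]
      exact Nat.le_mul_of_pos_left _ (by positivity)
    · exact Nat.zero_le _
  have hV1 : Lacunary.packBase p φ.natDegree ^ (2 * φ.natDegree) ≤ V := by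
    rw [hV, mul_assoc]
    exact Nat.le_mul_of_pos_right _ (by positivity)
  have hV2 : 2 * k ^ 2 + 2 ≤ V := by
    rw [hV]
    exact (Nat.le_mul_of_pos_left _ hBpos).trans (Nat.le_mul_of_pos_right _ (by positivity))
  obtain ⟨M', m, hm, hrun, -, hout⟩ := Lacunary.ensures_zeroTest (M := RAM.init x)
    (inp := fun i => x.getD i 0) (V := V) (hφ := hφ)
    (Q := fun M' => M' 1 0 = if Lacunary.poly u v a α β = 0 then 1 else 0)
    (by funext i; simp [RAM.init]) (fun i => by simp [RAM.init]) hL hs hV1 hV2 hαβ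
    (fun M' c hc h => by simpa only [Lacunary.poly_eq_zero_iff rfl hc hαβ] using h) hbdd
  obtain ⟨t, hexec, ht⟩ := hrun.exec
  refine ⟨t, M' 1 0, ⟨M', hexec, rfl⟩, ?_, ?_, ?_⟩
  · rw [hq]
    refine ht.trans (Nat.mul_le_mul (hm.trans ?_) (Nat.mul_le_mul_left _
      (Nat.pow_le_pow_left hlenV 2)))
    have hpL' : Nat.size p ≤ L := (Nat.le_succ _).trans hpL
    unfold Lacunary.stepBound
    gcongr
  · rw [hout]
    split_ifs with h <;> simp [h]
  · rw [hout]
    split_ifs with h <;> simp [h]
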